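/- Let $\Bbbk$ be an algebraically closed field, let $n\ge 0$ and $m\ge 1$ be integers, and let $S=\Bbbk[x_0,\dots,x_n,y_0,\dots,y_m]$ be the Cox ring of $\mathbb P^n\times\mathbb P^m$, graded by $\mathbb Z^2$ with $\deg x_i=(1,0)$ and $\deg y_j=(0,1)$. Put $\langle\mathbf x\rangle=\langle x_0,\dots,x_n\rangle$, $\langle\mathbf y\rangle=\langle y_0,\dots,y_m\rangle$ and $B=\langle\mathbf x\rangle\cap\langle\mathbf y\rangle$, and for an $S$-module $M$ let $\Gamma_B(M)=\{z\in M : B^s z=0\text{ for some } s\in\mathbb N\}$. A complex $F_\bullet=(F_0\leftarrow F_1\leftarrow\cdots)$ of finitely generated $\mathbb Z^2$-graded free $S$-modules is a *virtual resolution* of a finitely generated $\mathbb Z^2$-graded $S$-module $M$ if for each $i>0$ some power of $B$ annihilates $H_i(F_\bullet)$, and $H_0(F_\bullet)/\Gamma_B(H_0(F_\bullet))\cong M/\Gamma_B(M)$ as graded modules. Let $X$ be a nonempty finite set of points in $\mathbb P^n\times\mathbb P^m$, let $I_X\subseteq S$ be its homogeneous vanishing ideal (generated by the bihomogeneous polynomials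 that vanish at every point of $X$), and let $\ell=|\pi_1(X)|$ be the number of distinct first coordinates of points of $X$, where $\pi_1:\mathbb P^n\times\mathbb P^m\to\mathbb P^n$ is the projection. Then for every integer $t\ge \ell-1$, the minimal $\mathbb Z^2$-graded free resolution of $S/(I_X\cap\langle\mathbf x\rangle^t)$ (which exists) is a virtual resolution of $S/I_X$, and it has length exactly $n+m$. -/

import Mathlib

noncomputable section

namespace BiProj

/-- The Cox ring `S = k[x₀, …, xₙ, y₀, …, yₘ]` of `ℙⁿ × ℙᵐ`; `Sum.inl i` indexes `xᵢ` and
`Sum.inr j` indexes `yⱼ`. -/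
abbrev Cox (k : Type*) [Field k] (n m : ℕ) : Type _ :=
  MvPolynomial (Fin (n + 1) ⊕ Fin (m + 1)) k

/-- The points of `ℙⁿ × ℙᵐ` over `k`. -/
abbrev Points (k : Type*) [Field k] (n m : ℕ) : Type _ :=
  Projectivization k (Fin (n + 1) → k) × Projectivization k (Fin (m + 1) → k)

/-- The degrees of the variables: `deg xᵢ = (1, 0)` and `deg yⱼ = (0, 1)` in `ℤ²`. -/
def bideg (n m : ℕ) : Fin (n + 1) ⊕ Fin (m + 1) → ℤ × ℤ :=
  Sum.elim (fun _ => (1, 0)) (fun _ => (0, 1))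

variable {k : Type*} [Field k] {n m : ℕ}

/-- `f` is bihomogeneous of degree `e ∈ ℤ²` (the zero polynomial has every degree; when `e` has a
negative entry it is the only one). -/
def IsBihom (f : Cox k n m) (e : ℤ × ℤ) : Prop :=
  MvPolynomial.IsWeightedHomogeneous (bideg n m) f e

variable (k n m) in
/-- The graded piece `S_e`. -/
def piece (e : ℤ × ℤ) : AddSubgroup (Cox k n m) :=
  (MvPolynomial.weightedHomogeneousSubmodule k (bideg n m) e).toAddSubgroup

variable (k n m) in
/-- The ideal `⟨x⟩ = ⟨x₀, …, xₙ⟩`. -/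
def xIdeal : Ideal (Cox k n m) :=
  Ideal.span (Set.range fun i : Fin (n + 1) => MvPolynomial.X (Sum.inl i))

variable (k n m) in
/-- The ideal `⟨y⟩ = ⟨y₀, …, yₘ⟩`. -/
def yIdeal : Ideal (Cox k n m) :=
  Ideal.span (Set.range fun j : Fin (m + 1) => MvPolynomial.X (Sum.inr j))

variable (k n m) in
/-- The irrelevant ideal `B = ⟨x⟩ ∩ ⟨y⟩`. -/
def irrelevant : Ideal (Cox k n m) :=
  xIdeal k n m ⊓ yIdeal k n m

variable (k n m) in
/-- The homogeneous maximal ideal `⟨x, y⟩`, generated by all the variables. -/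
def varIdeal : Ideal (Cox k n m) :=
  Ideal.span (Set.range MvPolynomial.X)

/-- `f` vanishes at the point `p`: it takes the value `0` at every choice of homogeneous coordinates
of `p`. -/
def VanishesAt (f : Cox k n m) (p : Points k n m) : Prop :=
  ∀ (u : Fin (n + 1) → k) (v : Fin (m + 1) → k) (hu : u ≠ 0) (hv : v ≠ 0),
    (Projectivization.mk k u hu, Projectivization.mk k v hv) = p →
      MvPolynomial.eval (Sum.elim u v) f = 0

/-- The homogeneous vanishing ideal `I_X`, generated by the bihomogeneous polynomials that vanish at
every point of `X`. -/
def vanishingIdeal (X : Set (Points k n m)) : Ideal (Cox k n m) :=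
  Ideal.span {f | (∃ e, IsBihom f e) ∧ ∀ p ∈ X, VanishesAt f p}

/-- The grading of `S / I`: the degree `e` piece is the image of `S_e`. -/
def quotPiece (I : Ideal (Cox k n m)) (e : ℤ × ℤ) : AddSubgroup (Cox k n m ⧸ I) :=
  (piece k n m e).map (Ideal.Quotient.mk I).toAddMonoidHom

/-- `Γ_B(M)`: the elements of `M` that are killed by some power of the irrelevant ideal. -/
def gammaB (M : Type*) [AddCommGroup M] [Module (Cox k n m) M] : Submodule (Cox k n m) M where
  carrier := {x | ∃ t : ℕ, ∀ b ∈ irrelevant k n m ^ t, b • x = 0}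
  zero_mem' := ⟨0, fun b _ => smul_zero b⟩
  add_mem' := by
    rintro x y ⟨s, hs⟩ ⟨t, ht⟩
    refine ⟨s + t, fun b hb => ?_⟩
    rw [smul_add, hs b (Ideal.pow_le_pow_right (Nat.le_add_right s t) hb),
      ht b (Ideal.pow_le_pow_right (Nat.le_add_left t s) hb), add_zero]
  smul_mem' := by
    rintro c x ⟨t, ht⟩
    exact ⟨t, fun b hb => by rw [smul_comm, ht b hb, smul_zero]⟩

/-- The grading that `M / Γ_B(M)` inherits from the grading `G` of `M`. -/
def modGammaPiece {M : Type*} [AddCommGroup M] [Module (Cox k n m) M]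
    (G : ℤ × ℤ → AddSubgroup M) (e : ℤ × ℤ) :
    AddSubgroup (M ⧸ gammaB (k := k) (n := n) (m := m) M) :=
  (G e).map (gammaB (k := k) (n := n) (m := m) M).mkQ.toAddMonoidHom

/-- The modules `M` and `N`, graded by `G` and `H`, are isomorphic as graded `S`-modules: there is an
`S`-linear isomorphism that identifies the degree `e` pieces for every `e`. -/
def GradedIso {M N : Type*} [AddCommGroup M] [Module (Cox k n m) M]
    [AddCommGroup N] [Module (Cox k n m) N]
    (G : ℤ × ℤ → AddSubgroup M) (H : ℤ × ℤ → AddSubgroup N) : Prop :=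
  ∃ φ : M ≃ₗ[Cox k n m] N, ∀ e x, x ∈ G e ↔ φ x ∈ H e

variable (k n m) in
/-- A complex `F₀ ← F₁ ← F₂ ← ⋯` of finitely generated `ℤ²`-graded free `S`-modules. Here `Fᵢ` is the
direct sum of the `S(-shift i a)` over `a : Fin (rank i)`, that is, `shift i a` is the degree of
the `a`-th basis element, and `mat i` is the matrix of the differential `Fᵢ₊₁ → Fᵢ`, which is
homogeneous of degree `0`. -/
structure FreeComplex where
  rank : ℕ → ℕ
  shift : (i : ℕ) → Fin (rank i) → ℤ × ℤ
  mat : (i : ℕ) → Matrix (Fin (rank i)) (Fin (rank (i + 1))) (Cox k n m)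
  isBihom_mat : ∀ i a b, IsBihom (mat i a b) (shift (i + 1) b - shift i a)
  mat_mul_mat : ∀ i, mat i * mat (i + 1) = 0

namespace FreeComplex

variable (F : FreeComplex k n m)

/-- The underlying module of `Fᵢ`. -/
abbrev Mod (i : ℕ) : Type _ := Fin (F.rank i) → Cox k n m

/-- The differential `Fᵢ₊₁ → Fᵢ`. -/
def d (i : ℕ) : F.Mod (i + 1) →ₗ[Cox k n m] F.Mod i := (F.mat i).mulVecLin

/-- The degree `e` piece of `Fᵢ`. -/
def modPiece (i : ℕ) (e : ℤ × ℤ) : AddSubgroup (F.Mod i) :=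
  AddSubgroup.pi Set.univ fun a => piece k n m (e - F.shift i a)

/-- The cycles in `Fᵢ`: all of `F₀` when `i = 0`, and the kernel of `Fᵢ → Fᵢ₋₁` when `i > 0`. -/
def cycles : (i : ℕ) → Submodule (Cox k n m) (F.Mod i)
  | 0 => ⊤
  | i + 1 => LinearMap.ker (F.d i)

/-- The homology module `Hᵢ(F)`. -/
abbrev Homology (i : ℕ) : Type _ :=
  F.cycles i ⧸ (LinearMap.range (F.d i)).submoduleOf (F.cycles i)

/-- The degree `e` piece of `Hᵢ(F)`. -/
def homologyPiece (i : ℕ) (e : ℤ × ℤ) : AddSubgroup (F.Homology i) :=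
  ((F.modPiece i e).comap (F.cycles i).subtype.toAddMonoidHom).map
    ((LinearMap.range (F.d i)).submoduleOf (F.cycles i)).mkQ.toAddMonoidHom

/-- `F` is a graded free resolution of the module `M` graded by `G`: the homology vanishes in
positive homological degrees and `H₀(F) ≅ M` as graded modules. -/
def IsResolution {M : Type*} [AddCommGroup M] [Module (Cox k n m) M]
    (G : ℤ × ℤ → AddSubgroup M) : Prop :=
  (∀ i, 0 < i → Subsingleton (F.Homology i)) ∧
    GradedIso (k := k) (n := n) (m := m) (F.homologyPiece 0) G

/-- `F` is minimal: every differential maps `Fᵢ₊₁` into `⟨x, y⟩ Fᵢ`, that is, all matrix entries lie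
in `⟨x, y⟩`. -/
def IsMinimal : Prop := ∀ i a b, F.mat i a b ∈ varIdeal k n m

/-- `F` is a minimal graded free resolution of `M`. -/
def IsMinimalResolution {M : Type*} [AddCommGroup M] [Module (Cox k n m) M]
    (G : ℤ × ℤ → AddSubgroup M) : Prop :=
  F.IsResolution G ∧ F.IsMinimal

/-- `F` is a virtual resolution of the module `M` graded by `G`: every `Hᵢ(F)` with `i > 0` is
killed by a power of `B`, and `H₀(F) / Γ_B(H₀(F)) ≅ M / Γ_B(M)` as graded modules. -/
def IsVirtualResolution {M : Type*} [AddCommGroup M] [Module (Cox k n m) M]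
    (G : ℤ × ℤ → AddSubgroup M) : Prop :=
  (∀ i, 0 < i → ∃ t : ℕ, ∀ b ∈ irrelevant k n m ^ t, ∀ z : F.Homology i, b • z = 0) ∧
    GradedIso (k := k) (n := n) (m := m)
      (modGammaPiece (k := k) (n := n) (m := m) (F.homologyPiece 0))
      (modGammaPiece (k := k) (n := n) (m := m) G)

/-- `F` has length exactly `p`: `F_p ≠ 0` and `Fᵢ = 0` for all `i > p`. -/
def HasLength (p : ℕ) : Prop := F.rank p ≠ 0 ∧ ∀ i, p < i → F.rank i = 0

end FreeComplex

end BiProj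

end

/-! Write J = I_X ∩ ⟨x⟩^t. Any minimal resolution of S/J is virtual for S/I_X for a formal reason:
its higher homology vanishes, and J ⊆ I_X with B^t I_X ⊆ J, so S/J and S/I_X agree modulo B-torsion.
The content is the length n + m.

Upper bound. The ring S has n + m + 2 variables, so by the principle of Auslander and Buchsbaum it
suffices to find a regular sequence of length two on S/J that extends to a coordinate system. Choose
linear forms h(y) and g(x) that vanish at no point of π₂(X) and π₁(X) respectively, and a variable
y_{j₁} independent of h. The sequence is h, g + y_{j₁}; it is not bihomogeneous, but the argument
does not need that. The form h is regular modulo I_X because it vanishes nowhere on the cone over X,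
and modulo ⟨x⟩^t because its x-degree is 0 (`mul_yForm_regular`). For the second element
(`xForm_add_regular`), comparing lowest x-degrees, where only y_{j₁} acts, reduces to f ∈ ⟨x⟩^t.
Comparing highest x-degrees, where only g acts, then moves f into J + (h), because in x-degrees ≥ ℓ
- 1 multiplication by g is surjective on S/I_X. The last fact is interpolation on π₁(X), and there t
≥ ℓ - 1 enters.

Lower bound. For p ∈ X, some s ∈ ⟨x⟩^t vanishes on X except at p. It is nonzero in S/J and is killed
by the n + m independent linear forms vanishing at p, which forces F_{n+m} ≠ 0.

Both bounds use an elementary substitute for Tor: exactness of a complex of free modules modulo an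
ideal (`ExactMod`), followed along a regular sequence of S. Existence of a minimal resolution comes
from iterating minimal systems of homogeneous generators. -/

section ExactModulo

/-! ### Exactness modulo an ideal, and the length of a complex of free modules. -/

variable {R : Type*} [CommRing R] {r : ℕ → ℕ}

/-- The sequence of maps `d` is exact at its term of index `i + 1`, modulo the ideal `I`. -/
def ExactMod (d : (i : ℕ) → (Fin (r (i + 1)) → R) →ₗ[R] (Fin (r i) → R)) (I : Ideal R) (i : ℕ) :
    Prop :=
  ∀ v, (∀ a, d i v a ∈ I) → ∃ w, ∀ a, (v - d (i + 1) w) a ∈ I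

variable {d : (i : ℕ) → (Fin (r (i + 1)) → R) →ₗ[R] (Fin (r i) → R)} {I : Ideal R} {z : R} {i : ℕ}

theorem exists_forall_sub_smul_mem {ι : Type*} {v : ι → R} (hv : ∀ a, v a ∈ I ⊔ Ideal.span {z}) :
    ∃ c : ι → R, ∀ a, (v - z • c) a ∈ I := by
  have : ∀ a, ∃ c, v a - z * c ∈ I := fun a => by
    obtain ⟨y, hy, w, hw, h⟩ := Submodule.mem_sup.1 (hv a)
    obtain ⟨c, rfl⟩ := Ideal.mem_span_singleton'.1 hw
    exact ⟨c, by rw [← h]; convert hy using 1; ring⟩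
  choose c hc using this
  exact ⟨c, hc⟩

/-- If d v ≡ z u modulo I, injectivity of z on the cokernel of d modulo I (the hypothesis `hu`)
gives u ≡ d w. Then v - z w is a cycle modulo I, hence a boundary. -/
theorem ExactMod.sup_span (h : ExactMod d I i)
    (hu : ∀ u v, (∀ a, (z • u - d i v) a ∈ I) → ∃ w, ∀ a, (u - d i w) a ∈ I) :
    ExactMod d (I ⊔ Ideal.span {z}) i := by
  intro v hv
  obtain ⟨u, hu'⟩ := exists_forall_sub_smul_mem hv
  obtain ⟨w, hw⟩ := hu u v fun a => by
    have := I.neg_mem (hu' a)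
    rwa [← Pi.neg_apply, neg_sub] at this
  obtain ⟨w', hw'⟩ := h (v - z • w) fun a => by
    have := I.add_mem (hu' a) (I.mul_mem_left z (hw a))
    convert this using 1
    simp [mul_sub]
  refine ⟨w', fun a => ?_⟩
  have h1 := (le_sup_left : I ≤ I ⊔ Ideal.span {z}) (hw' a)
  have h2 : z * w a ∈ I ⊔ Ideal.span {z} :=
    Ideal.mul_mem_right _ _ ((le_sup_right : Ideal.span {z} ≤ _) (Ideal.mem_span_singleton_self z))
  convert Ideal.add_mem _ h1 h2 using 1
  simp only [Pi.sub_apply, Pi.smul_apply, smul_eq_mul]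
  ring

/-- The injectivity required by `ExactMod.sup_span` follows from exactness one place lower: z u ≡ d
v gives z (d u) ≡ 0, so d u ≡ 0, as z is regular on R/I. -/
theorem ExactMod.succ (hdd : ∀ i v, d i (d (i + 1) v) = 0) (hz : ∀ u, z * u ∈ I → u ∈ I)
    (h : ExactMod d I i) (h' : ExactMod d I (i + 1)) :
    ExactMod d (I ⊔ Ideal.span {z}) (i + 1) := by
  refine h'.sup_span fun u v huv => h u fun a => hz _ ?_
  have := Ideal.map_pi I _ huv (d i) a
  simpa [hdd] using this

/-- Each application of `ExactMod.succ` costs one homological degree, so e further elements of the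
sequence leave exactness from index e on. -/
theorem ExactMod.of_seq (hdd : ∀ i v, d i (d (i + 1) v) = 0) {J : ℕ → Ideal R} {z : ℕ → R} {N : ℕ}
    (hJ : ∀ j < N, J (j + 1) = J j ⊔ Ideal.span {z j})
    (hz : ∀ j < N, ∀ u, z j * u ∈ J j → u ∈ J j) {q : ℕ} (h : ∀ i, ExactMod d (J q) i) (e : ℕ)
    (he : q + e ≤ N) (i : ℕ) : ExactMod d (J (q + e)) (e + i) := by
  induction e generalizing i with
  | zero => simpa using h i
  | succ e ih =>
    have h1 := ih (by omega) i
    have h2 := ih (by omega) (i + 1)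
    have := ExactMod.succ hdd (hz (q + e) (by omega)) h1 h2
    rw [← hJ _ (by omega)] at this
    rwa [add_right_comm e 1 i]

/-- A minimal complex that is exact modulo an ideal containing the entries of its differentials
vanishes. -/
theorem ExactMod.rank_eq_zero (h : ExactMod d I i) (hI : I ≠ ⊤) (h0 : ∀ v a, d i v a ∈ I)
    (h1 : ∀ v a, d (i + 1) v a ∈ I) : r (i + 1) = 0 := by
  by_contra hr
  obtain ⟨w, hw⟩ := h (fun _ => 1) (h0 _)
  refine hI ((Ideal.eq_top_iff_one I).2 ?_)
  let a : Fin (r (i + 1)) := ⟨0, Nat.pos_of_ne_zero hr⟩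
  have := I.add_mem (hw a) (h1 w a)
  simpa using this

/-- If `s` is a nonzero element of the cokernel of an exact complex that is killed by a regular
sequence of length `N`, then the complex has length at least `N`. -/
theorem rank_ne_zero_of_regular_seq (hdd : ∀ i v, d i (d (i + 1) v) = 0) {J : ℕ → Ideal R}
    {z : ℕ → R} {N : ℕ} (hJ0 : J 0 = ⊥) (hJ : ∀ j < N, J (j + 1) = J j ⊔ Ideal.span {z j})
    (hz : ∀ j < N, ∀ u, z j * u ∈ J j → u ∈ J j) (h : ∀ i, ExactMod d ⊥ i) {s : Fin (r 0) → R}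
    (hs : ∀ w, s ≠ d 0 w) (hzs : ∀ j < N, ∃ w, z j • s = d 0 w) : r N ≠ 0 := by
  -- Dimension shift: a class in coker(d j) modulo J j that is nonzero and killed by the remaining z
  -- l is moved to one with the same properties for j + 1, by writing z j • s ≡ d j u and passing
  -- from s to u.
  have key : ∀ j ≤ N, ∃ s : Fin (r j) → R, (¬ ∃ w, ∀ a, (s - d j w) a ∈ J j) ∧
      ∀ l < N, j ≤ l → ∃ w, ∀ a, (z l • s - d j w) a ∈ J j := by
    intro j hj
    induction j with
    | zero =>
      refine ⟨s, ?_, fun l hl _ => ?_⟩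
      · rintro ⟨w, hw⟩
        refine hs w (funext fun a => ?_)
        simpa [hJ0, sub_eq_zero] using hw a
      · obtain ⟨w, hw⟩ := hzs l hl
        exact ⟨w, fun a => by simp [hw]⟩
    | succ j ih =>
      obtain ⟨s, hs, hl⟩ := ih (by omega)
      obtain ⟨u, hu⟩ := hl j (by omega) le_rfl
      have hE : ExactMod d (J j) j := by
        have := ExactMod.of_seq hdd hJ hz (q := 0) (by simpa [hJ0] using h) j (by omega) 0
        simpa using this
      rw [hJ j (by omega)]
      refine ⟨u, ?_, fun l hlN hjl => ?_⟩
      · rintro ⟨w, hw⟩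
        obtain ⟨c, hc⟩ := exists_forall_sub_smul_mem hw
        -- If u ≡ d w + z j • c, then z j • s ≡ d u ≡ z j • d c; cancelling z j would make s a
        -- boundary.
        refine hs ⟨c, fun a => hz j (by omega) _ ?_⟩
        have h1 := Ideal.map_pi _ _ hc (d j) a
        have h2 := hu a
        convert Ideal.add_mem _ h1 h2 using 1
        simp [hdd, mul_sub]
      · obtain ⟨u', hu'⟩ := hl l hlN (by omega)
        -- Both z l • u and z j • u' are mapped to z l z j s modulo J j, so their difference is a
        -- cycle, hence a boundary.
        obtain ⟨w, hw⟩ := hE (z l • u - z j • u') fun a => by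
          have h1 := Ideal.mul_mem_left _ (z l) (hu a)
          have h2 := Ideal.mul_mem_left _ (z j) (hu' a)
          convert Ideal.sub_mem _ h2 h1 using 1
          simp only [map_sub, map_smul, Pi.sub_apply, Pi.smul_apply, smul_eq_mul]
          ring
        refine ⟨w, fun a => ?_⟩
        have h1 := (le_sup_left : J j ≤ J j ⊔ Ideal.span {z j}) (hw a)
        have h2 : z j * u' a ∈ J j ⊔ Ideal.span {z j} :=
          Ideal.mul_mem_right _ _
            ((le_sup_right : Ideal.span {z j} ≤ _) (Ideal.mem_span_singleton_self (z j)))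
        convert Ideal.add_mem _ h1 h2 using 1
        simp only [Pi.sub_apply, Pi.smul_apply, smul_eq_mul]
        ring
  obtain ⟨s, hs, -⟩ := key N le_rfl
  intro hr
  -- Over an empty index set the nonvanishing of the class of s is contradictory.
  exact hs ⟨0, fun a => absurd a.2 (by omega)⟩

end ExactModulo

/-! ### Graded free modules and the existence of minimal resolutions. -/

namespace MvPolynomial

variable {R σ M : Type*} [CommSemiring R]

theorem IsWeightedHomogeneous.weightedHomogeneousComponent_mul [AddCancelCommMonoid M] {w : σ → M}
    {p : MvPolynomial σ R} {i : M} (hp : p.IsWeightedHomogeneous w i) (q : MvPolynomial σ R) (j : M) :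
    weightedHomogeneousComponent w (i + j) (p * q) = p * weightedHomogeneousComponent w j q := by
  classical
  let := weightedGradedAlgebra R w
  have := DirectSum.coe_decompose_mul_add_of_left_mem (weightedHomogeneousSubmodule R w) (j := j)
    (b := q) ((mem_weightedHomogeneousSubmodule R w i p).2 hp)
  erw [weightedDecomposition.decompose'_apply, weightedDecomposition.decompose'_apply] at this
  exact this

end MvPolynomial

namespace BiProj

open MvPolynomial

variable {k : Type*} [Field k] {n m : ℕ}

theorem mem_varIdeal_iff {f : Cox k n m} : f ∈ varIdeal k n m ↔ coeff 0 f = 0 := by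
  rw [varIdeal, ← Set.image_univ, mem_ideal_span_X_image]
  constructor
  · intro h
    by_contra h0
    obtain ⟨i, -, hi⟩ := h 0 (mem_support_iff.2 h0)
    exact hi rfl
  · intro h d hd
    by_contra! hd'
    have : d = 0 := Finsupp.ext fun i => hd' i (Set.mem_univ i)
    exact mem_support_iff.1 hd (this ▸ h)

theorem weight_bideg_fst (d : Fin (n + 1) ⊕ Fin (m + 1) →₀ ℕ) :
    (Finsupp.weight (bideg n m) d).1 = ∑ i, (d (Sum.inl i) : ℤ) := by
  simp [Finsupp.weight_apply, Finsupp.sum_fintype, bideg, Prod.fst_sum]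

theorem weight_bideg_snd (d : Fin (n + 1) ⊕ Fin (m + 1) →₀ ℕ) :
    (Finsupp.weight (bideg n m) d).2 = ∑ j, (d (Sum.inr j) : ℤ) := by
  simp [Finsupp.weight_apply, Finsupp.sum_fintype, bideg, Prod.snd_sum]

theorem eq_zero_of_weight_bideg {d : Fin (n + 1) ⊕ Fin (m + 1) →₀ ℕ}
    (hd : Finsupp.weight (bideg n m) d = 0) : d = 0 := by
  have h1 := weight_bideg_fst d
  have h2 := weight_bideg_snd d
  rw [hd] at h1 h2
  have h1' := (Finset.sum_eq_zero_iff_of_nonneg fun i _ => by positivity).1 h1.symm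
  have h2' := (Finset.sum_eq_zero_iff_of_nonneg fun i _ => by positivity).1 h2.symm
  ext (i | j)
  · exact_mod_cast h1' i (Finset.mem_univ i)
  · exact_mod_cast h2' j (Finset.mem_univ j)

/-- A nonzero constant term forces degree (0, 0), and the only monomial of that degree is 1. -/
theorem IsBihom.eq_C {f : Cox k n m} {e : ℤ × ℤ} (hf : IsBihom f e) (h0 : f ∉ varIdeal k n m) :
    f = C (coeff 0 f) := by
  rw [mem_varIdeal_iff] at h0
  have he : e = 0 := by simpa using (hf h0).symm
  ext d
  rw [coeff_C]
  split_ifs with hd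
  · rw [hd]
  · by_contra hd'
    exact hd (eq_zero_of_weight_bideg ((hf hd').trans he)).symm

section GradedSubmodules

variable {r r' : ℕ} {sh : Fin r → ℤ × ℤ} {sh' : Fin r' → ℤ × ℤ}

/-- The component of degree `e` of an element of the graded free module `⨁ₐ S(-sh a)`. -/
noncomputable def vecComponent (sh : Fin r → ℤ × ℤ) (e : ℤ × ℤ) (v : Fin r → Cox k n m) : Fin r → Cox k n m :=
  fun a => weightedHomogeneousComponent (bideg n m) (e - sh a) (v a)

/-- Homogeneous elements of degree `e` of the graded free module `⨁ₐ S(-sh a)`. -/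
def IsHomVec (sh : Fin r → ℤ × ℤ) (e : ℤ × ℤ) (v : Fin r → Cox k n m) : Prop :=
  ∀ a, IsBihom (v a) (e - sh a)

/-- Graded submodules of the graded free module `⨁ₐ S(-sh a)`. -/
def IsGradedSub (sh : Fin r → ℤ × ℤ) (K : Submodule (Cox k n m) (Fin r → Cox k n m)) : Prop :=
  ∀ v ∈ K, ∀ e, vecComponent sh e v ∈ K

theorem isHomVec_vecComponent (e : ℤ × ℤ) (v : Fin r → Cox k n m) :
    IsHomVec sh e (vecComponent sh e v) :=
  fun _ => weightedHomogeneousComponent_isWeightedHomogeneous _ _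

theorem exists_sum_vecComponent (sh : Fin r → ℤ × ℤ) (v : Fin r → Cox k n m) :
    ∃ E : Finset (ℤ × ℤ), v = ∑ e ∈ E, vecComponent sh e v := by
  classical
  refine ⟨Finset.univ.biUnion fun a =>
    (v a).support.image fun d => Finsupp.weight (bideg n m) d + sh a, ?_⟩
  ext a d
  rw [Finset.sum_apply, coeff_sum]
  simp only [vecComponent, coeff_weightedHomogeneousComponent]
  by_cases hd : coeff d (v a) = 0
  · simp [hd]
  · rw [Finset.sum_eq_single (Finsupp.weight (bideg n m) d + sh a)]
    · simp
    · intro e _ he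
      rw [if_neg]
      rintro h
      exact he (by rw [h]; abel)
    · intro h
      refine absurd (Finset.mem_biUnion.2 ⟨a, Finset.mem_univ a, Finset.mem_image.2 ⟨d, ?_, rfl⟩⟩) h
      exact mem_support_iff.2 hd

theorem IsGradedSub.span_eq {K : Submodule (Cox k n m) (Fin r → Cox k n m)}
    (hK : IsGradedSub sh K) :
    Submodule.span (Cox k n m) {v | v ∈ K ∧ ∃ e, IsHomVec sh e v} = K := by
  refine le_antisymm (Submodule.span_le.2 fun v hv => hv.1) fun v hv => ?_
  obtain ⟨E, hE⟩ := exists_sum_vecComponent sh v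
  rw [hE]
  exact Submodule.sum_mem _ fun e _ =>
    Submodule.subset_span ⟨hK v hv e, e, isHomVec_vecComponent e v⟩

theorem IsGradedSub.exists_generators {K : Submodule (Cox k n m) (Fin r → Cox k n m)}
    (hK : IsGradedSub sh K) :
    ∃ N, ∃ (g : Fin N → Fin r → Cox k n m) (sh' : Fin N → ℤ × ℤ),
      (∀ b, IsHomVec sh (sh' b) (g b)) ∧ Submodule.span (Cox k n m) (Set.range g) = K := by
  have hfg : K.FG := IsNoetherian.noetherian K
  rw [← hK.span_eq, Submodule.fg_span_iff_fg_span_finset_subset] at hfg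
  obtain ⟨T, hT, hspan⟩ := hfg
  have h : ∀ b : Fin T.card, ∃ e, IsHomVec sh e (T.equivFin.symm b).1 :=
    fun b => (hT (T.equivFin.symm b).2).2
  choose sh' hsh' using h
  refine ⟨T.card, fun b => (T.equivFin.symm b).1, sh', hsh', ?_⟩
  rw [← hK.span_eq, hspan]
  congr 1
  ext v
  constructor
  · rintro ⟨b, rfl⟩
    exact (T.equivFin.symm b).2
  · intro hv
    exact ⟨T.equivFin ⟨v, hv⟩, by simp⟩

theorem vecComponent_mulVec {A : Matrix (Fin r) (Fin r') (Cox k n m)}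
    (hA : ∀ a b, IsBihom (A a b) (sh' b - sh a)) (e : ℤ × ℤ) (v : Fin r' → Cox k n m) :
    vecComponent sh e (A.mulVec v) = A.mulVec (vecComponent sh' e v) := by
  ext1 a
  simp only [vecComponent, Matrix.mulVec, dotProduct, map_sum]
  refine Finset.sum_congr rfl fun b _ => ?_
  rw [← IsWeightedHomogeneous.weightedHomogeneousComponent_mul (hA a b)]
  congr 2
  abel

theorem isGradedSub_ker {A : Matrix (Fin r) (Fin r') (Cox k n m)}
    (hA : ∀ a b, IsBihom (A a b) (sh' b - sh a)) :
    IsGradedSub sh' (LinearMap.ker A.mulVecLin) := by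
  intro v hv e
  rw [LinearMap.mem_ker, Matrix.mulVecLin_apply] at hv ⊢
  rw [← vecComponent_mulVec hA, hv]
  ext1 a
  simp [vecComponent]

/-- A graded submodule of a free module has a matrix of homogeneous generators whose syzygies
have no unit entries. -/
theorem IsGradedSub.exists_minimal_cover {K : Submodule (Cox k n m) (Fin r → Cox k n m)}
    (hK : IsGradedSub sh K) :
    ∃ (N : ℕ) (sh' : Fin N → ℤ × ℤ) (A : Matrix (Fin r) (Fin N) (Cox k n m)),
      (∀ a b, IsBihom (A a b) (sh' b - sh a)) ∧ LinearMap.range A.mulVecLin = K ∧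
      ∀ v e, A.mulVec v = 0 → IsHomVec sh' e v → ∀ b, v b ∈ varIdeal k n m := by
  classical
  have hex := hK.exists_generators
  -- Minimality is taken as the least possible number of homogeneous generators.
  obtain ⟨g, sh', hg, hspan⟩ := Nat.find_spec hex
  have hmin := fun N => Nat.find_min (m := N) hex
  generalize Nat.find hex = N at g sh' hmin
  refine ⟨N, sh', Matrix.of fun a b => g b a, fun a b => hg b a, ?_, fun v e hv hve b => ?_⟩
  · rw [Matrix.range_mulVecLin, ← hspan]
    rfl
  · by_contra hb
    obtain ⟨N, rfl⟩ : ∃ N', N = N' + 1 := ⟨N - 1, by have := b.2; omega⟩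
    refine hmin N (Nat.lt_succ_self N) ⟨fun c => g (b.succAbove c), fun c => sh' (b.succAbove c),
      fun c => hg _, le_antisymm ?_ ?_⟩
    · rw [← hspan]
      refine Submodule.span_mono ?_
      rintro _ ⟨c, rfl⟩
      exact ⟨_, rfl⟩
    · rw [← hspan, Submodule.span_le]
      rintro _ ⟨c, rfl⟩
      obtain rfl | ⟨c, rfl⟩ := Fin.eq_self_or_eq_succAbove b c
      -- The offending entry of the homogeneous syzygy is a nonzero constant, so the generator g c
      -- is a combination of the others, against minimality.
      · have hC := (hve c).eq_C hb
        rw [mem_varIdeal_iff] at hb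
        have hsum : v c • g c + ∑ j, v (c.succAbove j) • g (c.succAbove j) = 0 := by
          rw [← Fin.sum_univ_succAbove (fun b => v b • g b) c, ← hv]
          ext1 a
          simp [Matrix.mulVec, dotProduct, Finset.sum_apply, mul_comm]
        have hgc : g c = (-C (coeff 0 (v c))⁻¹ : Cox k n m) •
            ∑ j, v (c.succAbove j) • g (c.succAbove j) := by
          rw [← neg_eq_iff_add_eq_zero.2 hsum, smul_neg, neg_smul, neg_neg, smul_smul]
          nth_rw 2 [hC]
          rw [← C_mul, inv_mul_cancel₀ hb, C_1, one_smul]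
        rw [hgc]
        exact Submodule.smul_mem _ _ (Submodule.sum_mem _ fun j _ =>
          Submodule.smul_mem _ _ (Submodule.subset_span ⟨j, rfl⟩))
      · exact Submodule.subset_span ⟨c, rfl⟩

end GradedSubmodules

variable (k n m) in
/-- A graded free module with a graded submodule. -/
structure GradedSub where
  rank : ℕ
  shift : Fin rank → ℤ × ℤ
  sub : Submodule (Cox k n m) (Fin rank → Cox k n m)
  isGradedSub : IsGradedSub shift sub

namespace GradedSub

theorem exists_next (G : GradedSub k n m) :
    ∃ (G' : GradedSub k n m) (A : Matrix (Fin G.rank) (Fin G'.rank) (Cox k n m)),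
      (∀ a b, IsBihom (A a b) (G'.shift b - G.shift a)) ∧ LinearMap.range A.mulVecLin = G.sub ∧
      LinearMap.ker A.mulVecLin = G'.sub ∧
      ∀ v ∈ G'.sub, ∀ e, IsHomVec G'.shift e v → ∀ b, v b ∈ varIdeal k n m := by
  obtain ⟨N, sh', A, h1, h2, h3⟩ := G.isGradedSub.exists_minimal_cover
  exact ⟨⟨N, sh', LinearMap.ker A.mulVecLin, isGradedSub_ker h1⟩, A, h1, h2, rfl,
    fun v hv e he b => h3 v e hv he b⟩

/-- The syzygies of a minimal system of homogeneous generators. -/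
noncomputable def next (G : GradedSub k n m) : GradedSub k n m := G.exists_next.choose

/-- A minimal system of homogeneous generators. -/
noncomputable def gens (G : GradedSub k n m) : Matrix (Fin G.rank) (Fin G.next.rank) (Cox k n m) :=
  G.exists_next.choose_spec.choose

variable (G : GradedSub k n m)

theorem isBihom_gens (a b) : IsBihom (G.gens a b) (G.next.shift b - G.shift a) :=
  G.exists_next.choose_spec.choose_spec.1 a b

theorem range_gens : LinearMap.range G.gens.mulVecLin = G.sub :=
  G.exists_next.choose_spec.choose_spec.2.1

theorem ker_gens : LinearMap.ker G.gens.mulVecLin = G.next.sub :=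
  G.exists_next.choose_spec.choose_spec.2.2.1

theorem mem_varIdeal_of_mem_next {v} (hv : v ∈ G.next.sub) {e} (he : IsHomVec G.next.shift e v)
    (b) : v b ∈ varIdeal k n m :=
  G.exists_next.choose_spec.choose_spec.2.2.2 v hv e he b

theorem gens_col_mem (b) : G.gens.col b ∈ G.sub := by
  rw [← G.range_gens, Matrix.range_mulVecLin]
  exact Submodule.subset_span ⟨b, rfl⟩

/-- The iterated syzygies. -/
noncomputable def iter : ℕ → GradedSub k n m
  | 0 => G
  | i + 1 => (iter i).next

/-- The minimal free resolution of the quotient by a graded submodule. -/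
noncomputable def complex : FreeComplex k n m where
  rank i := (G.iter i).rank
  shift i := (G.iter i).shift
  mat i := (G.iter i).gens
  isBihom_mat i := (G.iter i).isBihom_gens
  mat_mul_mat i := by
    ext1 a b
    have h : (G.iter (i + 1)).gens.col b ∈ LinearMap.ker (G.iter i).gens.mulVecLin := by
      rw [ker_gens]
      exact gens_col_mem _ b
    exact congrFun h a

/-- Only the first matrix needs the hypothesis; the columns of every later one are homogeneous
syzygies of a minimal system of generators. -/
theorem complex_isMinimal (h : ∀ v ∈ G.sub, ∀ a, v a ∈ varIdeal k n m) : G.complex.IsMinimal := by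
  rintro (_ | i) a b
  · exact h _ (G.gens_col_mem b) a
  · exact (G.iter i).mem_varIdeal_of_mem_next ((G.iter (i + 1)).gens_col_mem b)
      (fun a => (G.iter (i + 1)).isBihom_gens a b) a

theorem complex_subsingleton (i : ℕ) : Subsingleton (G.complex.Homology (i + 1)) := by
  rw [Submodule.Quotient.subsingleton_iff, Submodule.submoduleOf, Submodule.comap_subtype_eq_top]
  change LinearMap.ker (G.iter i).gens.mulVecLin ≤ LinearMap.range (G.iter (i + 1)).gens.mulVecLin
  rw [ker_gens, range_gens]
  rfl

end GradedSub

/-- A homogeneous proper ideal contained in the ideal of the variables has a minimal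
free resolution. -/
theorem exists_isMinimalResolution {J : Ideal (Cox k n m)}
    (hJ : ∀ f ∈ J, ∀ e, weightedHomogeneousComponent (bideg n m) e f ∈ J)
    (hJ' : J ≤ varIdeal k n m) :
    ∃ F : FreeComplex k n m, F.IsMinimalResolution (quotPiece J) := by
  let π : (Fin 1 → Cox k n m) →ₗ[Cox k n m] Cox k n m := LinearMap.proj 0
  let G : GradedSub k n m :=
    { rank := 1
      shift := 0
      sub := Submodule.comap π J
      isGradedSub := fun v hv e => hJ _ hv _ }
  refine ⟨G.complex, ⟨fun i hi => ?_, ?_⟩, G.complex_isMinimal fun v hv a => ?_⟩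
  · obtain ⟨i, rfl⟩ : ∃ j, i = j + 1 := ⟨i - 1, by omega⟩
    exact G.complex_subsingleton i
  · have hr : LinearMap.range (G.complex.d 0) = Submodule.comap π J := G.range_gens
    let ψ : G.complex.cycles 0 →ₗ[Cox k n m] Cox k n m ⧸ J :=
      Submodule.mkQ J ∘ₗ π ∘ₗ (G.complex.cycles 0).subtype
    have hψ : ∀ v, ψ v = Ideal.Quotient.mk J (π v.1) := fun v => rfl
    have hker : (LinearMap.range (G.complex.d 0)).submoduleOf (G.complex.cycles 0) =
        LinearMap.ker ψ := by
      rw [hr]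
      ext v
      rw [LinearMap.mem_ker, hψ, Ideal.Quotient.eq_zero_iff_mem]
      rfl
    have hsurj : Function.Surjective ψ := by
      intro q
      obtain ⟨f, rfl⟩ := Ideal.Quotient.mk_surjective q
      exact ⟨⟨fun _ => f, Submodule.mem_top⟩, rfl⟩
    let Ψ := (Submodule.quotEquivOfEq _ _ hker).trans (ψ.quotKerEquivOfSurjective hsurj)
    refine ⟨Ψ, fun e x => ⟨?_, fun hx => ?_⟩⟩
    · rintro ⟨v, hv, rfl⟩
      refine ⟨π v.1, ?_, rfl⟩
      have := hv (0 : Fin 1) (Set.mem_univ _)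
      change π v.1 ∈ piece k n m (e - 0) at this
      rwa [sub_zero] at this
    · obtain ⟨f, hf, hfx⟩ := hx
      refine ⟨⟨fun _ => f, Submodule.mem_top⟩, ?_, Ψ.injective hfx⟩
      intro a _
      change f ∈ piece k n m (e - 0)
      rwa [sub_zero]
  · rw [Subsingleton.elim a 0]
    exact hJ' hv

end BiProj

/-! ### Components for the x- and y-gradings, powers of ⟨x⟩, and the ideal of the cone over X. -/

namespace MvPolynomial

/-- The coefficients of `f` along the curve `s ↦ p s * T ^ w s` are the values at `p` of the
weighted homogeneous components of `f`. -/
theorem coeff_aeval_C_mul_X_pow {k A σ : Type*} [Finite σ] [CommSemiring k] [CommSemiring A]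
    [Algebra k A] (w : σ → ℕ) (p : σ → A) (f : MvPolynomial σ k) (a : ℕ) :
    (aeval (fun s => Polynomial.C (p s) * Polynomial.X ^ w s) f).coeff a =
      aeval p (weightedHomogeneousComponent w a f) := by
  classical
  have := Fintype.ofFinite σ
  induction f using MvPolynomial.induction_on' with
  | monomial d c =>
    have hd := isWeightedHomogeneous_monomial w d c rfl
    rw [weightedHomogeneousComponent_of_mem ((mem_weightedHomogeneousSubmodule k w _ _).2 hd),
      apply_ite (aeval p), map_zero, aeval_monomial, aeval_monomial]
    rw [Finsupp.prod_fintype _ _ fun _ => pow_zero _, Finsupp.prod_fintype _ _ fun _ => pow_zero _]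
    simp only [mul_pow, Finset.prod_mul_distrib, ← pow_mul, Finset.prod_pow_eq_pow_sum, ← map_pow,
      ← map_prod, Polynomial.algebraMap_apply]
    rw [← mul_assoc, ← Polynomial.C_mul, Polynomial.coeff_C_mul_X_pow, Finsupp.weight_apply,
      Finsupp.sum_fintype d (fun i c => c • w i) fun _ => zero_smul ℕ _]
    simp only [smul_eq_mul, mul_comm]
  | add p q hp hq => simp only [map_add, Polynomial.coeff_add, hp, hq]

end MvPolynomial

namespace BiProj

open MvPolynomial

variable {k : Type*} [Field k] {n m : ℕ}

variable (n m) in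
/-- The degree in the variables `xᵢ`. -/
def xWeight : Fin (n + 1) ⊕ Fin (m + 1) → ℕ := Sum.elim (fun _ => 1) (fun _ => 0)

variable (n m) in
/-- The degree in the variables `yⱼ`. -/
def yWeight : Fin (n + 1) ⊕ Fin (m + 1) → ℕ := Sum.elim (fun _ => 0) (fun _ => 1)

theorem weight_xWeight (d : Fin (n + 1) ⊕ Fin (m + 1) →₀ ℕ) :
    Finsupp.weight (xWeight n m) d = ∑ i, d (Sum.inl i) := by
  simp [Finsupp.weight_apply, Finsupp.sum_fintype, xWeight]

theorem weight_yWeight (d : Fin (n + 1) ⊕ Fin (m + 1) →₀ ℕ) :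
    Finsupp.weight (yWeight n m) d = ∑ j, d (Sum.inr j) := by
  simp [Finsupp.weight_apply, Finsupp.sum_fintype, yWeight]

theorem weight_bideg (d : Fin (n + 1) ⊕ Fin (m + 1) →₀ ℕ) :
    Finsupp.weight (bideg n m) d =
      ((Finsupp.weight (xWeight n m) d : ℤ), (Finsupp.weight (yWeight n m) d : ℤ)) := by
  apply Prod.ext
  · rw [weight_bideg_fst, weight_xWeight]; push_cast; rfl
  · rw [weight_bideg_snd, weight_yWeight]; push_cast; rfl

theorem bihomComponent_natCast (f : Cox k n m) (a b : ℕ) :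
    weightedHomogeneousComponent (bideg n m) ((a : ℤ), (b : ℤ)) f =
      weightedHomogeneousComponent (xWeight n m) a
        (weightedHomogeneousComponent (yWeight n m) b f) := by
  classical
  ext d
  simp only [coeff_weightedHomogeneousComponent, weight_bideg, Prod.mk.injEq, Nat.cast_inj, ite_and]

theorem bihomComponent_eq_zero_or (f : Cox k n m) (e : ℤ × ℤ) :
    weightedHomogeneousComponent (bideg n m) e f = 0 ∨ ∃ a b : ℕ, e = ((a : ℤ), (b : ℤ)) := by
  by_cases h : ∃ d : Fin (n + 1) ⊕ Fin (m + 1) →₀ ℕ, Finsupp.weight (bideg n m) d = e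
  · obtain ⟨d, rfl⟩ := h
    exact Or.inr ⟨_, _, weight_bideg d⟩
  · exact Or.inl (weightedHomogeneousComponent_eq_zero' _ _ fun d _ hd => h ⟨d, hd⟩)

/-- An ideal that is stable under the `x`- and `y`-gradings is stable under the bigrading. -/
theorem bihomComponent_mem {J : Ideal (Cox k n m)}
    (hx : ∀ f ∈ J, ∀ a, weightedHomogeneousComponent (xWeight n m) a f ∈ J)
    (hy : ∀ f ∈ J, ∀ b, weightedHomogeneousComponent (yWeight n m) b f ∈ J)
    {f : Cox k n m} (hf : f ∈ J) (e : ℤ × ℤ) :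
    weightedHomogeneousComponent (bideg n m) e f ∈ J := by
  obtain h | ⟨a, b, rfl⟩ := bihomComponent_eq_zero_or f e
  · rw [h]
    exact zero_mem _
  · rw [bihomComponent_natCast]
    exact hx _ (hy _ hf _) _

section XIdeal

/-- The substitution xᵢ ↦ xᵢ T sends ⟨x⟩^t into (T^t), and the coefficients of the image of f are
its x-components. Conversely, every monomial of x-degree at least t lies in ⟨x⟩^t. -/
theorem mem_xIdeal_pow {t : ℕ} {f : Cox k n m} :
    f ∈ xIdeal k n m ^ t ↔ ∀ a < t, weightedHomogeneousComponent (xWeight n m) a f = 0 := by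
  constructor
  · intro hf
    let φ : Cox k n m →ₐ[k] Polynomial (Cox k n m) :=
      aeval fun s => Polynomial.C (X s) * Polynomial.X ^ xWeight n m s
    have h1 : (xIdeal k n m).map φ ≤ Ideal.span {Polynomial.X} := by
      rw [xIdeal, Ideal.map_span, Ideal.span_le]
      rintro _ ⟨_, ⟨i, rfl⟩, rfl⟩
      simp [φ, xWeight, Ideal.mem_span_singleton]
    have h2 : φ f ∈ Ideal.span {(Polynomial.X : Polynomial (Cox k n m)) ^ t} := by
      rw [← Ideal.span_singleton_pow]
      refine Ideal.pow_right_mono h1 t ?_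
      rw [← Ideal.map_pow]
      exact Ideal.mem_map_of_mem φ hf
    intro a ha
    have := Polynomial.X_pow_dvd_iff.1 (Ideal.mem_span_singleton.1 h2) a ha
    rwa [coeff_aeval_C_mul_X_pow, aeval_X_left, AlgHom.id_apply] at this
  · intro hf
    classical
    rw [f.as_sum]
    refine Ideal.sum_mem _ fun d hd => ?_
    have ht : t ≤ Finsupp.weight (xWeight n m) d := by
      by_contra! hlt
      have := congrArg (coeff d) (hf _ hlt)
      rw [coeff_weightedHomogeneousComponent, if_pos rfl, coeff_zero] at this
      exact mem_support_iff.1 hd this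
    rw [weight_xWeight] at ht
    rw [monomial_eq, Finsupp.prod_fintype _ _ (by simp), Fintype.prod_sum_type]
    refine Ideal.mul_mem_left _ _ (Ideal.mul_mem_right _ _ (Ideal.pow_le_pow_right ht ?_))
    rw [← Finset.prod_pow_eq_pow_sum]
    exact Ideal.prod_mem_prod fun i _ =>
      Ideal.pow_mem_pow (Ideal.subset_span (Set.mem_range_self i)) _

theorem xComponent_mem_xIdeal_pow {t : ℕ} {f : Cox k n m} (hf : f ∈ xIdeal k n m ^ t) (a : ℕ) :
    weightedHomogeneousComponent (xWeight n m) a f ∈ xIdeal k n m ^ t := by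
  classical
  rw [mem_xIdeal_pow] at hf ⊢
  intro b hb
  rw [weightedHomogeneousComponent_of_mem (weightedHomogeneousComponent_mem _ f a)]
  split_ifs with h
  · rw [← h, hf b hb]
  · rfl

theorem yComponent_mem_xIdeal_pow {t : ℕ} {f : Cox k n m} (hf : f ∈ xIdeal k n m ^ t) (b : ℕ) :
    weightedHomogeneousComponent (yWeight n m) b f ∈ xIdeal k n m ^ t := by
  classical
  rw [mem_xIdeal_pow] at hf ⊢
  intro a ha
  ext d
  have := congrArg (coeff d) (hf a ha)
  simp only [coeff_weightedHomogeneousComponent, coeff_zero] at this ⊢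
  split_ifs at this ⊢ <;> simp_all

end XIdeal

section VanishingIdeal

/-- The affine cone over a set of points. -/
def cone (X : Set (Points k n m)) : Set ((Fin (n + 1) → k) × (Fin (m + 1) → k)) :=
  {q | ∃ (hu : q.1 ≠ 0) (hv : q.2 ≠ 0),
    (Projectivization.mk k q.1 hu, Projectivization.mk k q.2 hv) ∈ X}

/-- The ideal of the polynomials that vanish on the cone over `X`. -/
noncomputable def coneIdeal (X : Set (Points k n m)) : Ideal (Cox k n m) :=
  ⨅ q ∈ cone X, RingHom.ker (eval (Sum.elim q.1 q.2))

variable {X : Set (Points k n m)}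

theorem mem_coneIdeal {f : Cox k n m} :
    f ∈ coneIdeal X ↔ ∀ q ∈ cone X, eval (Sum.elim q.1 q.2) f = 0 := by
  simp [coneIdeal, RingHom.mem_ker]

theorem smul_mem_cone {q : (Fin (n + 1) → k) × (Fin (m + 1) → k)} (hq : q ∈ cone X) {a b : k}
    (ha : a ≠ 0) (hb : b ≠ 0) : (a • q.1, b • q.2) ∈ cone X := by
  obtain ⟨hu, hv, h⟩ := hq
  refine ⟨smul_ne_zero ha hu, smul_ne_zero hb hv, ?_⟩
  convert h using 2
  · exact (Projectivization.mk_eq_mk_iff' k _ _ _ _).2 ⟨a, rfl⟩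
  · exact (Projectivization.mk_eq_mk_iff' k _ _ _ _).2 ⟨b, rfl⟩

/-- On the orbit of q under the torus action of weight w, f is a polynomial in the parameter whose
coefficients are the values at q of its components. It vanishes at all nonzero parameters, hence
identically, as k is infinite. -/
theorem component_mem_coneIdeal [Infinite k] {w : Fin (n + 1) ⊕ Fin (m + 1) → ℕ}
    (hw : ∀ q ∈ cone X, ∀ c : k, c ≠ 0 → ∃ q' ∈ cone X,
      Sum.elim q'.1 q'.2 = fun s => Sum.elim q.1 q.2 s * c ^ w s)
    {f : Cox k n m} (hf : f ∈ coneIdeal X) (a : ℕ) :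
    weightedHomogeneousComponent w a f ∈ coneIdeal X := by
  rw [mem_coneIdeal] at hf ⊢
  intro q hq
  rw [← aeval_eq_eval, ← coeff_aeval_C_mul_X_pow]
  suffices h : aeval (fun s => Polynomial.C (Sum.elim q.1 q.2 s) * Polynomial.X ^ w s) f = 0 by
    rw [h, Polynomial.coeff_zero]
  -- The extra factor T takes care of the parameter 0, at which the orbit may leave the cone.
  suffices h : Polynomial.X *
      aeval (fun s => Polynomial.C (Sum.elim q.1 q.2 s) * Polynomial.X ^ w s) f = 0 from
    (mul_eq_zero.1 h).resolve_left Polynomial.X_ne_zero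
  refine Polynomial.funext fun c => ?_
  rw [Polynomial.eval_mul, Polynomial.eval_X, Polynomial.eval_zero]
  by_cases hc : c = 0
  · rw [hc, zero_mul]
  · obtain ⟨q', hq', h⟩ := hw q hq c hc
    have := hf q' hq'
    rw [h] at this
    rw [← Polynomial.coe_aeval_eq_eval, comp_aeval_apply]
    simp only [map_mul, map_pow, Polynomial.aeval_C, Polynomial.aeval_X, Algebra.algebraMap_self,
      RingHom.id_apply]
    rw [aeval_eq_eval, this, mul_zero]

theorem xComponent_mem_coneIdeal [Infinite k] {f : Cox k n m} (hf : f ∈ coneIdeal X) (a : ℕ) :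
    weightedHomogeneousComponent (xWeight n m) a f ∈ coneIdeal X := by
  refine component_mem_coneIdeal (fun q hq c hc =>
    ⟨_, smul_mem_cone hq hc one_ne_zero, ?_⟩) hf a
  ext (i | j) <;> simp [xWeight, mul_comm]

theorem yComponent_mem_coneIdeal [Infinite k] {f : Cox k n m} (hf : f ∈ coneIdeal X) (b : ℕ) :
    weightedHomogeneousComponent (yWeight n m) b f ∈ coneIdeal X := by
  refine component_mem_coneIdeal (fun q hq c hc =>
    ⟨_, smul_mem_cone hq one_ne_zero hc, ?_⟩) hf b
  ext (i | j) <;> simp [yWeight, mul_comm]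

/-- Turns membership in I_X into a pointwise condition that involves no generators. The cone is
stable under rescaling both factors, so its ideal contains the bihomogeneous components of its
elements. -/
theorem vanishingIdeal_eq_coneIdeal [Infinite k] (X : Set (Points k n m)) :
    vanishingIdeal X = coneIdeal X := by
  apply le_antisymm
  · refine Ideal.span_le.2 fun f hf => mem_coneIdeal.2 ?_
    rintro ⟨u, v⟩ ⟨hu, hv, h⟩
    exact hf.2 _ h u v hu hv rfl
  · intro f hf
    obtain ⟨E, hE⟩ := exists_sum_vecComponent (r := 1) 0 fun _ => f
    rw [show f = _ from congrFun hE 0, Finset.sum_apply]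
    refine Ideal.sum_mem _ fun e _ => Ideal.subset_span ⟨⟨_, isHomVec_vecComponent e _ 0⟩, ?_⟩
    rintro p hp u v hu hv rfl
    exact mem_coneIdeal.1 (bihomComponent_mem (fun _ => xComponent_mem_coneIdeal)
      (fun _ => yComponent_mem_coneIdeal) hf _) (u, v) ⟨hu, hv, hp⟩

end VanishingIdeal

end BiProj

/-! ### Coordinate systems as regular sequences. -/

namespace MvPolynomial

theorem mem_span_X_image_of_X_mul_mem {R σ : Type*} [CommRing R] {s : Set σ} {j : σ} (hj : j ∉ s)
    {u : MvPolynomial σ R}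
    (h : X j * u ∈ Ideal.span (X '' s : Set (MvPolynomial σ R))) :
    u ∈ Ideal.span (X '' s : Set (MvPolynomial σ R)) := by
  classical
  rw [mem_ideal_span_X_image] at h ⊢
  intro d hd
  obtain ⟨i, hi, hne⟩ := h (Finsupp.single j 1 + d) (by
    rw [mem_support_iff, coeff_X_mul]
    exact mem_support_iff.1 hd)
  refine ⟨i, hi, ?_⟩
  have hij : j ≠ i := fun e => hj (e ▸ hi)
  simpa [Finsupp.single_apply, hij] using hne

theorem mem_span_equiv_X_image_of_mul_mem {R σ : Type*} [CommRing R]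
    (φ : MvPolynomial σ R ≃ₐ[R] MvPolynomial σ R) {s : Set σ} {j : σ} (hj : j ∉ s)
    {u : MvPolynomial σ R} (h : φ (X j) * u ∈ Ideal.span ((fun i => φ (X i)) '' s)) :
    u ∈ Ideal.span ((fun i => φ (X i)) '' s) := by
  have hs : Ideal.span ((fun i => φ (X i)) '' s) =
      (Ideal.span (X '' s : Set (MvPolynomial σ R))).map φ := by
    rw [Ideal.map_span, Set.image_image]
  rw [hs, Ideal.mem_map_of_equiv] at h ⊢
  obtain ⟨f, hf, hfu⟩ := h
  refine ⟨φ.symm u, mem_span_X_image_of_X_mul_mem hj ?_, φ.apply_symm_apply u⟩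
  convert hf
  apply φ.injective
  rw [map_mul, φ.apply_symm_apply, hfu]

/-- The images of distinct variables under an automorphism form a regular sequence. -/
theorem exists_regular_seq {R σ : Type*} [CommRing R]
    (φ : MvPolynomial σ R ≃ₐ[R] MvPolynomial σ R) {N : ℕ} {e : Fin N → σ}
    (he : Function.Injective e) :
    ∃ (J : ℕ → Ideal (MvPolynomial σ R)) (z : ℕ → MvPolynomial σ R), J 0 = ⊥ ∧
      (∀ j < N, J (j + 1) = J j ⊔ Ideal.span {z j}) ∧
      (∀ j < N, ∀ u, z j * u ∈ J j → u ∈ J j) ∧ (∀ i : Fin N, z i = φ (X (e i))) ∧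
      J N = Ideal.span ((fun i => φ (X i)) '' Set.range e) := by
  refine ⟨fun j => Ideal.span ((fun i => φ (X i)) '' (e '' {i | i.1 < j})),
    fun j => if h : j < N then φ (X (e ⟨j, h⟩)) else 0, by simp, fun j hj => ?_,
    fun j hj u hu => ?_, fun i => by simp, ?_⟩
  · beta_reduce
    rw [dif_pos hj, ← Ideal.span_union]
    congr 1
    have : {i : Fin N | i.1 < j + 1} = {i | i.1 < j} ∪ {⟨j, hj⟩} := by
      ext i
      simp only [Set.mem_ofPred_eq, Set.mem_union, Set.mem_singleton_iff, Fin.ext_iff]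
      omega
    rw [this, Set.image_union, Set.image_union, Set.image_singleton, Set.image_singleton]
  · beta_reduce at hu
    rw [dif_pos hj] at hu
    refine mem_span_equiv_X_image_of_mul_mem φ ?_ hu
    rintro ⟨i, hi, hij⟩
    rw [he hij] at hi
    exact lt_irrefl j hi
  · simp

/-- The automorphism that rescales the variables and adds to some of them polynomials in
variables that it fixes. -/
theorem exists_equiv_X {k σ : Type*} [Field k] (b : σ → k) (L : σ → MvPolynomial σ k)
    (hb : ∀ s, b s ≠ 0) (hL : ∀ s, L s ∈ Algebra.adjoin k (X '' {t | b t = 1 ∧ L t = 0})) :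
    ∃ φ : MvPolynomial σ k ≃ₐ[k] MvPolynomial σ k, ∀ s, φ (X s) = C (b s) * X s + L s := by
  let φ : MvPolynomial σ k →ₐ[k] MvPolynomial σ k := aeval fun s => C (b s) * X s + L s
  -- Both maps fix every L s, which involves only variables with b = 1 and L = 0; hence they are
  -- mutually inverse.
  let ψ : MvPolynomial σ k →ₐ[k] MvPolynomial σ k := aeval fun s => C (b s)⁻¹ * (X s - L s)
  have hφ : ∀ s, φ (L s) = L s := fun s => by
    refine (AlgHom.eqOn_adjoin_iff (φ := φ) (ψ := AlgHom.id k _)).2 ?_ (hL s)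
    rintro _ ⟨t, ⟨h1, h2⟩, rfl⟩
    simp [φ, h1, h2]
  have hψ : ∀ s, ψ (L s) = L s := fun s => by
    refine (AlgHom.eqOn_adjoin_iff (φ := ψ) (ψ := AlgHom.id k _)).2 ?_ (hL s)
    rintro _ ⟨t, ⟨h1, h2⟩, rfl⟩
    simp [ψ, h1, h2]
  have hC : ∀ (s) (f : MvPolynomial σ k), C (b s) * (C (b s)⁻¹ * f) = f := fun s f => by
    rw [← mul_assoc, ← C_mul, mul_inv_cancel₀ (hb s), C_1, one_mul]
  have hC' : ∀ (s) (f : MvPolynomial σ k), C (b s)⁻¹ * (C (b s) * f) = f := fun s f => by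
    rw [← mul_assoc, ← C_mul, inv_mul_cancel₀ (hb s), C_1, one_mul]
  have hφX : ∀ s, φ (X s) = C (b s) * X s + L s := fun s => aeval_X _ s
  have hψX : ∀ s, ψ (X s) = C (b s)⁻¹ * (X s - L s) := fun s => aeval_X _ s
  refine ⟨AlgEquiv.ofAlgHom φ ψ ?_ ?_, hφX⟩
  · ext1 s
    simp only [AlgHom.comp_apply, hψX, map_mul, map_sub, hφX, hφ, AlgHom.id_apply, algHom_C,
      algebraMap_eq, add_sub_cancel_right, hC']
  · ext1 s
    simp only [AlgHom.comp_apply, hψX, map_mul, map_add, hφX, hψ, AlgHom.id_apply, algHom_C,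
      algebraMap_eq, hC, sub_add_cancel]

end MvPolynomial

/-! ### Regularity on R/J read off from a presentation. -/

section Cokernel

variable {R : Type*} [CommRing R] {r : ℕ → ℕ}
  {d : (i : ℕ) → (Fin (r (i + 1)) → R) →ₗ[R] (Fin (r i) → R)} {I J : Ideal R} {z : R}

theorem LinearMap.exists_mem_mk_eq {ι : Type*} [Finite ι] (ψ : (ι → R) →ₗ[R] R ⧸ J) {c : ι → R}
    (hc : ∀ a, c a ∈ I) : ∃ f ∈ I, ψ c = Ideal.Quotient.mk J f := by
  classical
  have := Fintype.ofFinite ι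
  have h : ∀ a : ι, ∃ f, Ideal.Quotient.mk J f = ψ fun j => if a = j then 1 else 0 :=
    fun a => Ideal.Quotient.mk_surjective _
  choose f hf using h
  refine ⟨∑ a, c a * f a, Ideal.sum_mem _ fun a _ => Ideal.mul_mem_right _ _ (hc a), ?_⟩
  rw [ψ.pi_apply_eq_sum_univ, map_sum]
  refine Finset.sum_congr rfl fun a _ => ?_
  rw [← hf, map_mul, Algebra.smul_def]
  rfl

/-- Regularity on the cokernel `R ⧸ J` in terms of a presentation. -/
theorem exists_sub_mem_of_smul_sub_mem {ψ : (Fin (r 0) → R) →ₗ[R] R ⧸ J}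
    (hψ : Function.Surjective ψ) (hker : ∀ v, ψ v = 0 ↔ ∃ w, v = d 0 w)
    (hz : ∀ f, z * f ∈ J ⊔ I → f ∈ J ⊔ I) (u : Fin (r 0) → R) (v)
    (huv : ∀ a, (z • u - d 0 v) a ∈ I) : ∃ w, ∀ a, (u - d 0 w) a ∈ I := by
  obtain ⟨f, hf⟩ := Ideal.Quotient.mk_surjective (ψ u)
  obtain ⟨i, hi, hψi⟩ := ψ.exists_mem_mk_eq huv
  have hzf : z * f ∈ J ⊔ I := by
    rw [map_sub, (hker (d 0 v)).2 ⟨v, rfl⟩, sub_zero, map_smul, ← hf] at hψi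
    have : z * f - i ∈ J := Ideal.Quotient.eq.1 hψi
    rw [← sub_add_cancel (z * f) i]
    exact Submodule.add_mem_sup this hi
  obtain ⟨j, hj, i', hi', rfl⟩ := Submodule.mem_sup.1 (hz f hzf)
  obtain ⟨w₀, hw₀⟩ := hψ 1
  have : ψ (u - i' • w₀) = 0 := by
    rw [map_sub, map_smul, hw₀, ← hf, map_add, Ideal.Quotient.eq_zero_iff_mem.2 hj, zero_add,
      Algebra.smul_def, mul_one]
    exact sub_self _
  obtain ⟨w, hw⟩ := (hker _).1 this
  refine ⟨w, fun a => ?_⟩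
  rw [← hw, sub_sub_cancel]
  exact Ideal.mul_mem_right _ _ hi'

end Cokernel

/-! ### Linear forms and interpolation on π₁(X). -/

namespace MvPolynomial

theorem IsWeightedHomogeneous.eval_mul_pow {k σ : Type*} [Finite σ] [CommSemiring k] {w : σ → ℕ}
    {f : MvPolynomial σ k} {a : ℕ} (hf : f.IsWeightedHomogeneous w a) (p : σ → k) (c : k) :
    eval (fun s => p s * c ^ w s) f = eval p f * c ^ a := by
  have h : aeval (fun s => Polynomial.C (p s) * Polynomial.X ^ w s) f =
      Polynomial.C (eval p f) * Polynomial.X ^ a := by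
    classical
    ext b
    rw [coeff_aeval_C_mul_X_pow, Polynomial.coeff_C_mul_X_pow,
      weightedHomogeneousComponent_of_mem ((mem_weightedHomogeneousSubmodule k w _ _).2 hf)]
    split_ifs
    · rw [aeval_eq_eval]
    · rw [map_zero]
  have := congrArg (Polynomial.aeval c) h
  rw [comp_aeval_apply] at this
  simpa [aeval_eq_eval] using this

end MvPolynomial

namespace BiProj

open MvPolynomial

variable {k : Type*} [Field k] {n m : ℕ}

section LinearForms

variable (n m) in
/-- The linear form `∑ bᵢ xᵢ`. -/
noncomputable def xForm (b : Fin (n + 1) → k) : Cox k n m := ∑ i, C (b i) * X (Sum.inl i)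

variable (n m) in
/-- The linear form `∑ cⱼ yⱼ`. -/
noncomputable def yForm (c : Fin (m + 1) → k) : Cox k n m := ∑ j, C (c j) * X (Sum.inr j)

theorem eval_xForm (b u : Fin (n + 1) → k) (v : Fin (m + 1) → k) :
    eval (Sum.elim u v) (xForm n m b) = b ⬝ᵥ u := by
  simp [xForm, dotProduct]

theorem eval_yForm (c : Fin (m + 1) → k) (u : Fin (n + 1) → k) (v : Fin (m + 1) → k) :
    eval (Sum.elim u v) (yForm n m c) = c ⬝ᵥ v := by
  simp [yForm, dotProduct]

theorem isWeightedHomogeneous_xForm (b : Fin (n + 1) → k) :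
    (xForm n m b).IsWeightedHomogeneous (xWeight n m) 1 :=
  IsWeightedHomogeneous.sum _ _ _ fun i _ =>
    (isWeightedHomogeneous_X k (xWeight n m) (Sum.inl i)).C_mul _

theorem isWeightedHomogeneous_yForm (c : Fin (m + 1) → k) :
    (yForm n m c).IsWeightedHomogeneous (xWeight n m) 0 :=
  IsWeightedHomogeneous.sum _ _ _ fun j _ =>
    (isWeightedHomogeneous_X k (xWeight n m) (Sum.inr j)).C_mul _

theorem xForm_mem_xIdeal (b : Fin (n + 1) → k) : xForm n m b ∈ xIdeal k n m :=
  Ideal.sum_mem _ fun i _ => Ideal.mul_mem_left _ _ (Ideal.subset_span ⟨i, rfl⟩)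

theorem dual_eq_dotProduct {N : ℕ} (f : Module.Dual k (Fin N → k)) :
    ∃ c : Fin N → k, ∀ v, f v = c ⬝ᵥ v := by
  refine ⟨fun i => f (Pi.single i 1), fun v => ?_⟩
  rw [f.pi_apply_eq_sum_univ, dotProduct]
  refine Finset.sum_congr rfl fun i _ => ?_
  rw [smul_eq_mul, mul_comm]
  congr 2
  ext j
  simp [Pi.single_apply, eq_comm]

/-- A finite set of points is contained in the complement of a hyperplane. -/
theorem exists_forall_dotProduct_ne_zero [Infinite k] {N : ℕ}
    {T : Set (Projectivization k (Fin N → k))} (hT : T.Finite) :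
    ∃ c : Fin N → k, ∀ v (hv : v ≠ 0), Projectivization.mk k v hv ∈ T → c ⬝ᵥ v ≠ 0 := by
  have := hT.to_subtype
  obtain ⟨f, hf⟩ := Module.exists_dual_forall_apply_ne_zero (K := k)
    (fun p : T => p.1.rep) fun p => p.1.rep_nonzero
  obtain ⟨c, hc⟩ := dual_eq_dotProduct f
  refine ⟨c, fun v hv hvT h0 => hf ⟨_, hvT⟩ ?_⟩
  obtain ⟨a, ha⟩ := Projectivization.exists_smul_eq_mk_rep k v hv
  change f (Projectivization.mk k v hv).rep = 0
  rw [← ha, Units.smul_def, map_smul, hc, h0, smul_zero]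

/-- Two distinct points are separated by a hyperplane. -/
theorem exists_dotProduct_eq_zero_ne_zero {N : ℕ} {u v : Fin N → k} (hu : u ≠ 0) (hv : v ≠ 0)
    (h : Projectivization.mk k u hu ≠ Projectivization.mk k v hv) :
    ∃ b : Fin N → k, b ⬝ᵥ u ≠ 0 ∧ b ⬝ᵥ v = 0 := by
  have hmem : u ∉ Submodule.span k {v} := by
    intro hmem
    obtain ⟨a, ha⟩ := Submodule.mem_span_singleton.1 hmem
    exact h ((Projectivization.mk_eq_mk_iff' k _ _ _ _).2 ⟨a, ha⟩)
  obtain ⟨f, hf, hle⟩ := Submodule.exists_le_ker_of_notMem hmem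
  obtain ⟨b, hb⟩ := dual_eq_dotProduct f
  refine ⟨b, hb u ▸ hf, ?_⟩
  rw [← hb]
  exact hle (Submodule.mem_span_singleton_self v)

end LinearForms

section Interpolation

variable {X : Set (Points k n m)}

/-- Forms of degree `a` in `x` that separate `T`, when `T` has at most `a + 1` points. -/
theorem exists_interpolation {T : Set (Projectivization k (Fin (n + 1) → k))} (hT : T.Finite)
    {a : ℕ} (ha : T.ncard ≤ a + 1) {τ : Projectivization k (Fin (n + 1) → k)} (hτ : τ ∈ T) :
    ∃ E : Cox k n m, E.IsWeightedHomogeneous (xWeight n m) a ∧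
      (∀ v, eval (Sum.elim τ.rep v) E = 1) ∧
      ∀ τ' ∈ T, τ' ≠ τ → ∀ v, eval (Sum.elim τ'.rep v) E = 0 := by
  classical
  have hscale : ∀ b : Fin (n + 1) → k, b ⬝ᵥ τ.rep ≠ 0 → ((b ⬝ᵥ τ.rep)⁻¹ • b) ⬝ᵥ τ.rep = 1 :=
    fun b hb => by rw [smul_dotProduct, smul_eq_mul, inv_mul_cancel₀ hb]
  have hsep : ∀ τ' : Projectivization k (Fin (n + 1) → k), ∃ b : Fin (n + 1) → k,
      b ⬝ᵥ τ.rep = 1 ∧ (τ' ≠ τ → b ⬝ᵥ τ'.rep = 0) := by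
    intro τ'
    by_cases h : τ' = τ
    · obtain ⟨i, hi⟩ := Function.ne_iff.1 τ.rep_nonzero
      refine ⟨_, hscale (Pi.single i 1) ?_, fun h' => absurd h h'⟩
      rwa [single_one_dotProduct]
    · obtain ⟨b, h1, h2⟩ := exists_dotProduct_eq_zero_ne_zero τ.rep_nonzero τ'.rep_nonzero
        (by rw [Projectivization.mk_rep, Projectivization.mk_rep]; exact Ne.symm h)
      exact ⟨_, hscale b h1, fun _ => by rw [smul_dotProduct, h2, smul_zero]⟩
  choose b hb1 hb0 using hsep
  let U := hT.toFinset.erase τ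
  have hU : U.card ≤ a := by
    rw [Finset.card_erase_of_mem (hT.mem_toFinset.2 hτ), ← Set.ncard_eq_toFinset_card T hT]
    omega
  -- One linear form for each other point of T; the power of a form with value 1 at τ pads the
  -- degree up to a.
  refine ⟨xForm n m (b τ) ^ (a - U.card) * ∏ τ' ∈ U, xForm n m (b τ'), ?_, fun v => ?_,
    fun τ' hτ' hne v => ?_⟩
  · have h1 := (isWeightedHomogeneous_xForm (m := m) (b τ)).pow (a - U.card)
    have h2 := IsWeightedHomogeneous.prod U (fun τ' => xForm n m (b τ')) (fun _ => 1)
      (fun τ' _ => isWeightedHomogeneous_xForm (b τ'))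
    have := h1.mul h2
    rwa [Finset.sum_const, smul_eq_mul, smul_eq_mul, mul_one, mul_one,
      Nat.sub_add_cancel hU] at this
  · simp [eval_xForm, hb1, map_prod]
  · rw [map_mul, map_prod, Finset.prod_eq_zero (i := τ') _ _, mul_zero]
    · exact Finset.mem_erase.2 ⟨hne, hT.mem_toFinset.2 hτ'⟩
    · rw [eval_xForm, hb0 τ' hne]

theorem xWeight_smul (u : Fin (n + 1) → k) (v : Fin (m + 1) → k) (c : k) :
    Sum.elim (c • u) v = fun s => Sum.elim u v s * c ^ xWeight n m s := by
  ext (i | j) <;> simp [xWeight, mul_comm]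

/-- A form that is homogeneous in `x` vanishes on the cone over `X` as soon as it vanishes at chosen
representatives of the first coordinates. -/
theorem mem_coneIdeal_of_rep {f : Cox k n m} {a : ℕ}
    (hf : f.IsWeightedHomogeneous (xWeight n m) a)
    (h : ∀ τ ∈ Prod.fst '' X, ∀ v, (τ.rep, v) ∈ cone X → eval (Sum.elim τ.rep v) f = 0) :
    f ∈ coneIdeal X := by
  rw [mem_coneIdeal]
  rintro ⟨u, v⟩ ⟨hu, hv, hX⟩
  obtain ⟨c, hc⟩ := Projectivization.exists_smul_eq_mk_rep k u hu
  have h0 := h (Projectivization.mk k u hu) ⟨_, hX, rfl⟩ v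
    ⟨Projectivization.rep_nonzero _, hv, by rw [Projectivization.mk_rep]; exact hX⟩
  rw [← hc, Units.smul_def, xWeight_smul, hf.eval_mul_pow] at h0
  exact (mul_eq_zero.1 h0).resolve_right (pow_ne_zero _ c.ne_zero)

/-- In `x`-degrees `≥ |π₁(X)| - 1`, multiplication by a linear form that does not vanish on `π₁(X)`
is surjective modulo the ideal of `X`. -/
theorem exists_sub_xForm_mul_mem (hX : X.Finite) {a : ℕ} (ha : (Prod.fst '' X).ncard ≤ a + 1)
    {b : Fin (n + 1) → k} (hb : ∀ q ∈ cone X, b ⬝ᵥ q.1 ≠ 0)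
    {f : Cox k n m} (hf : f.IsWeightedHomogeneous (xWeight n m) (a + 1)) :
    ∃ f' : Cox k n m, f'.IsWeightedHomogeneous (xWeight n m) a ∧
      f - xForm n m b * f' ∈ coneIdeal X := by
  classical
  have hT := hX.image Prod.fst
  have hE : ∀ τ : Projectivization k (Fin (n + 1) → k), ∃ E : Cox k n m,
      E.IsWeightedHomogeneous (xWeight n m) a ∧ (τ ∈ Prod.fst '' X →
      (∀ v, eval (Sum.elim τ.rep v) E = 1) ∧
      ∀ τ' ∈ Prod.fst '' X, τ' ≠ τ → ∀ v, eval (Sum.elim τ'.rep v) E = 0) := by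
    intro τ
    by_cases hτ : τ ∈ Prod.fst '' X
    · obtain ⟨E, h1, h2, h3⟩ := exists_interpolation (m := m) hT ha hτ
      exact ⟨E, h1, fun _ => ⟨h2, h3⟩⟩
    · exact ⟨0, isWeightedHomogeneous_zero _ _ _, fun h => absurd h hτ⟩
  choose E hEh hE using hE
  let s : Projectivization k (Fin (n + 1) → k) → Cox k n m →ₐ[k] Cox k n m := fun τ =>
    aeval (Sum.elim (fun i => C (τ.rep i)) fun j => MvPolynomial.X (Sum.inr j))
  have hs : ∀ τ u v, eval (Sum.elim u v) (s τ f) = eval (Sum.elim τ.rep v) f := by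
    intro τ u v
    rw [← aeval_eq_eval, comp_aeval_apply, ← aeval_eq_eval]
    congr 2
    ext (i | j) <;> simp
  have hs0 : ∀ τ (q : Cox k n m), (s τ q).IsWeightedHomogeneous (xWeight n m) 0 := by
    intro τ q
    induction q using MvPolynomial.induction_on with
    | C c => simpa [s, algHom_C] using isWeightedHomogeneous_C (xWeight n m) c
    | add p q hp hq => rw [map_add]; exact hp.add hq
    | mul_X p i hp =>
      rw [map_mul, ← add_zero (0 : ℕ)]
      refine hp.mul ?_
      obtain i | j := i
      · simpa [s] using isWeightedHomogeneous_C (xWeight n m) (τ.rep i)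
      · simpa [s] using show IsWeightedHomogeneous (xWeight n m) _ 0 from
          isWeightedHomogeneous_X k (xWeight n m) (Sum.inr j)
  -- Lagrange interpolation with coefficients in k[y]: s τ f is f(τ, y), and division by the value
  -- of the linear form at τ makes the product with it agree with f over τ.
  refine ⟨∑ τ ∈ hT.toFinset, C (b ⬝ᵥ τ.rep)⁻¹ * (E τ * s τ f), ?_, ?_⟩
  · refine IsWeightedHomogeneous.sum _ _ _ fun τ _ => IsWeightedHomogeneous.C_mul ?_ _
    exact (hEh τ).mul (hs0 τ f)
  · refine mem_coneIdeal_of_rep (a := a + 1) (hf.sub ?_) fun τ hτ v hv => ?_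
    · rw [add_comm a 1]
      refine (isWeightedHomogeneous_xForm b).mul ?_
      refine IsWeightedHomogeneous.sum _ _ _ fun τ _ => IsWeightedHomogeneous.C_mul ?_ _
      exact (hEh τ).mul (hs0 τ f)
    · rw [map_sub, map_mul, map_sum, Finset.sum_eq_single τ, eval_xForm, map_mul, map_mul, eval_C,
        hs, (hE τ hτ).1, one_mul, mul_inv_cancel_left₀ (hb _ hv), sub_self]
      · intro τ' hτ' hne
        rw [map_mul, map_mul, (hE τ' (hT.mem_toFinset.1 hτ')).2 τ hτ hne.symm, zero_mul, mul_zero]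
      · exact fun h => absurd (hT.mem_toFinset.2 hτ) h

end Interpolation

/-! ### The regular sequence of length two on S/(I_X ∩ ⟨x⟩^t). -/

section Regularity

variable {X : Set (Points k n m)} {t : ℕ}

theorem mul_mem_coneIdeal_iff {h : Cox k n m}
    (hh : ∀ q ∈ cone X, eval (Sum.elim q.1 q.2) h ≠ 0) {f : Cox k n m} :
    h * f ∈ coneIdeal X ↔ f ∈ coneIdeal X := by
  simp only [mem_coneIdeal, map_mul]
  exact forall₂_congr fun q hq => by simp [hh q hq]

theorem mul_yForm_regular {c : Fin (m + 1) → k} (hc : ∀ q ∈ cone X, c ⬝ᵥ q.2 ≠ 0)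
    (hc0 : yForm n m c ≠ 0) {f : Cox k n m}
    (hf : yForm n m c * f ∈ coneIdeal X ⊓ xIdeal k n m ^ t) :
    f ∈ coneIdeal X ⊓ xIdeal k n m ^ t := by
  refine ⟨(mul_mem_coneIdeal_iff fun q hq => by rw [eval_yForm]; exact hc q hq).1 hf.1, ?_⟩
  have h2 := mem_xIdeal_pow.1 hf.2
  refine mem_xIdeal_pow.2 fun a ha => ?_
  have := h2 a ha
  rw [← zero_add a, (isWeightedHomogeneous_yForm c).weightedHomogeneousComponent_mul] at this
  exact (mul_eq_zero.1 this).resolve_left hc0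

/-- Induction on the lowest x-degree a < t: since g raises the x-degree, the component of (g + y) f'
in degree a is y f'_a. It lies in (h), hence so does f'_a, which can be dropped. -/
theorem exists_mem_xIdeal_pow_sub_mem {h g y : Cox k n m}
    (hh : h.IsWeightedHomogeneous (xWeight n m) 0) (hg : g ∈ xIdeal k n m)
    (hy : y.IsWeightedHomogeneous (xWeight n m) 0)
    (hyh : ∀ u, y * u ∈ Ideal.span {h} → u ∈ Ideal.span {h}) {f : Cox k n m}
    (hf : (g + y) * f ∈ xIdeal k n m ^ t ⊔ Ideal.span {h}) :
    ∃ f' ∈ xIdeal k n m ^ t, f - f' ∈ Ideal.span {h} := by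
  suffices H : ∀ a ≤ t, ∃ f' ∈ xIdeal k n m ^ a, f - f' ∈ Ideal.span {h} from H t le_rfl
  intro a ha
  induction a with
  | zero => exact ⟨f, by simp, by simp⟩
  | succ a ih =>
    obtain ⟨f', hf', hff'⟩ := ih (by omega)
    have h1 : (g + y) * f' ∈ xIdeal k n m ^ t ⊔ Ideal.span {h} := by
      have h2 : (g + y) * (f - f') ∈ xIdeal k n m ^ t ⊔ Ideal.span {h} :=
        Ideal.mul_mem_left _ _ (Ideal.mem_sup_right hff')
      convert Ideal.sub_mem _ hf h2 using 1
      ring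
    obtain ⟨j, hj, w, hw, hjw⟩ := Submodule.mem_sup.1 h1
    obtain ⟨w, rfl⟩ := Ideal.mem_span_singleton'.1 hw
    have hgf : weightedHomogeneousComponent (xWeight n m) a (g * f') = 0 := by
      refine (mem_xIdeal_pow (t := a + 1)).1 ?_ a (Nat.lt_succ_self a)
      rw [pow_succ']
      exact Ideal.mul_mem_mul hg hf'
    have hcomp := congrArg (weightedHomogeneousComponent (xWeight n m) a) hjw
    rw [map_add, mem_xIdeal_pow.1 hj a (by omega), zero_add, add_mul, map_add, hgf, zero_add,
      mul_comm w] at hcomp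
    have e1 := hh.weightedHomogeneousComponent_mul w a
    have e2 := hy.weightedHomogeneousComponent_mul f' a
    rw [zero_add] at e1 e2
    rw [e1, e2] at hcomp
    have hmem := hyh _ (hcomp ▸ Ideal.mul_mem_right _ _ (Ideal.mem_span_singleton_self h))
    refine ⟨f' - weightedHomogeneousComponent (xWeight n m) a f', ?_, ?_⟩
    · refine mem_xIdeal_pow.2 fun b hb => ?_
      classical
      rw [map_sub, weightedHomogeneousComponent_of_mem (weightedHomogeneousComponent_mem _ f' a)]
      split_ifs with hba
      · rw [hba, sub_self]
      · rw [sub_zero]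
        exact mem_xIdeal_pow.1 hf' b (by omega)
    · rw [← sub_add]
      exact Ideal.add_mem _ hff' hmem

/-- The second step of a regular sequence on `S ⧸ (I_X ∩ ⟨x⟩ ^ t)`. -/
theorem xForm_add_regular [Infinite k] (hX : X.Finite) (ht : (Prod.fst '' X).ncard ≤ t + 1)
    {b : Fin (n + 1) → k} (hb : ∀ q ∈ cone X, b ⬝ᵥ q.1 ≠ 0) {h y : Cox k n m}
    (hh : h.IsWeightedHomogeneous (xWeight n m) 0)
    (hy : y.IsWeightedHomogeneous (xWeight n m) 0)
    (hyh : ∀ u, y * u ∈ Ideal.span {h} → u ∈ Ideal.span {h}) {f : Cox k n m}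
    (hf : (xForm n m b + y) * f ∈ (coneIdeal X ⊓ xIdeal k n m ^ t) ⊔ Ideal.span {h}) :
    f ∈ (coneIdeal X ⊓ xIdeal k n m ^ t) ⊔ Ideal.span {h} := by
  classical
  -- Descending on a strict bound D for the x-degrees of f, the top component p is shown to lie in
  -- the ideal and is split off.
  have key : ∀ D, ∀ f ∈ xIdeal k n m ^ t,
      (∀ a ≥ D, weightedHomogeneousComponent (xWeight n m) a f = 0) →
      (xForm n m b + y) * f ∈ (coneIdeal X ⊓ xIdeal k n m ^ t) ⊔ Ideal.span {h} →
      f ∈ (coneIdeal X ⊓ xIdeal k n m ^ t) ⊔ Ideal.span {h} := by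
    intro D
    induction D with
    | zero =>
      intro f _ hf0 _
      rw [← sum_weightedHomogeneousComponent (xWeight n m) f]
      simp [hf0]
    | succ D ih =>
      intro f hft hfD hf
      by_cases hD : D < t
      · refine ih f hft (fun a ha => ?_) hf
        obtain rfl | ha := eq_or_lt_of_le ha
        · exact mem_xIdeal_pow.1 hft D hD
        · exact hfD a ha
      · set p := weightedHomogeneousComponent (xWeight n m) D f with hp
        have hpt : p ∈ xIdeal k n m ^ t := xComponent_mem_xIdeal_pow hft D
        have hpJ : p ∈ (coneIdeal X ⊓ xIdeal k n m ^ t) ⊔ Ideal.span {h} := by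
          obtain ⟨j, hj, w, hw, hjw⟩ := Submodule.mem_sup.1 hf
          obtain ⟨w, rfl⟩ := Ideal.mem_span_singleton'.1 hw
          have hcomp := congrArg (weightedHomogeneousComponent (xWeight n m) (D + 1)) hjw
          have e1 := hh.weightedHomogeneousComponent_mul w (D + 1)
          have e2 := hy.weightedHomogeneousComponent_mul f (D + 1)
          have e3 := (isWeightedHomogeneous_xForm (m := m) b).weightedHomogeneousComponent_mul f D
          rw [zero_add] at e1 e2
          rw [add_comm 1 D] at e3
          rw [mul_comm w, add_mul, map_add, map_add, e1, e2, e3, hfD _ le_rfl, mul_zero, add_zero,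
            ← hp] at hcomp
          -- The top component of the relation reads g p = j + h w, with j ∈ I_X and w of x-degree D
          -- + 1. As D ≥ t ≥ ℓ - 1, interpolation replaces w by g w' modulo I_X; cancelling g leaves
          -- p ≡ h w'.
          obtain ⟨w', hw'h, hw'⟩ := exists_sub_xForm_mul_mem hX (by omega) hb
            (weightedHomogeneousComponent_isWeightedHomogeneous (w := xWeight n m) (D + 1) w)
          have hmem : p - h * w' ∈ coneIdeal X := by
            rw [← mul_mem_coneIdeal_iff (h := xForm n m b)
              fun q hq => by rw [eval_xForm]; exact hb q hq]
            have := Ideal.add_mem _ (xComponent_mem_coneIdeal hj.1 (D + 1))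
              (Ideal.mul_mem_left _ h hw')
            convert this using 1
            rw [mul_sub, ← hcomp]
            ring
          have hw't : w' ∈ xIdeal k n m ^ t := mem_xIdeal_pow.2 fun a ha => by
            rw [weightedHomogeneousComponent_of_mem
              ((mem_weightedHomogeneousSubmodule k _ _ _).2 hw'h), if_neg (by omega)]
          rw [← sub_add_cancel p (h * w')]
          exact Submodule.add_mem_sup
            ⟨hmem, Ideal.sub_mem _ hpt (Ideal.mul_mem_left _ _ hw't)⟩
            (Ideal.mul_mem_right _ _ (Ideal.mem_span_singleton_self h))
        rw [← sub_add_cancel f p]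
        refine Ideal.add_mem _ (ih (f - p) (Ideal.sub_mem _ hft hpt) (fun a ha => ?_) ?_) hpJ
        · rw [map_sub, hp,
            weightedHomogeneousComponent_of_mem (weightedHomogeneousComponent_mem _ f D)]
          split_ifs with haD
          · rw [haD, sub_self]
          · rw [hfD a (by omega), sub_zero]
        · rw [mul_sub]
          exact Ideal.sub_mem _ hf (Ideal.mul_mem_left _ _ hpJ)
  have hxJ : (coneIdeal X ⊓ xIdeal k n m ^ t) ⊔ Ideal.span {h} ≤
      xIdeal k n m ^ t ⊔ Ideal.span {h} := sup_le_sup_right inf_le_right _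
  obtain ⟨f', hf', hff'⟩ := exists_mem_xIdeal_pow_sub_mem hh (xForm_mem_xIdeal b) hy hyh (hxJ hf)
  obtain ⟨D, hD⟩ := (weightedHomogeneousComponent_finsupp (w := xWeight n m) f').bddAbove
  rw [← sub_add_cancel f f']
  refine Ideal.add_mem _ (Ideal.mem_sup_right hff') (key (D + 1) f' hf' (fun a ha => ?_) ?_)
  · by_contra h0
    have := hD h0
    omega
  · have : (xForm n m b + y) * (f - f') ∈ (coneIdeal X ⊓ xIdeal k n m ^ t) ⊔ Ideal.span {h} :=
      Ideal.mul_mem_left _ _ (Ideal.mem_sup_right hff')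
    convert Ideal.sub_mem _ hf this using 1
    ring

end Regularity

/-! ### Graded isomorphisms modulo B-torsion. -/

section GradedIso

variable {M N P : Type*} [AddCommGroup M] [Module (Cox k n m) M]
  [AddCommGroup N] [Module (Cox k n m) N] [AddCommGroup P] [Module (Cox k n m) P]

theorem GradedIso.trans {G : ℤ × ℤ → AddSubgroup M} {H : ℤ × ℤ → AddSubgroup N}
    {K : ℤ × ℤ → AddSubgroup P} (h : GradedIso (k := k) (n := n) (m := m) G H)
    (h' : GradedIso (k := k) (n := n) (m := m) H K) :
    GradedIso (k := k) (n := n) (m := m) G K := by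
  obtain ⟨φ, hφ⟩ := h
  obtain ⟨ψ, hψ⟩ := h'
  exact ⟨φ.trans ψ, fun e x => (hφ e x).trans (hψ e _)⟩

theorem mem_gammaB {x : M} :
    x ∈ gammaB (k := k) (n := n) (m := m) M ↔ ∃ t : ℕ, ∀ b ∈ irrelevant k n m ^ t, b • x = 0 :=
  Iff.rfl

theorem GradedIso.modGamma {G : ℤ × ℤ → AddSubgroup M} {H : ℤ × ℤ → AddSubgroup N}
    (h : GradedIso (k := k) (n := n) (m := m) G H) :
    GradedIso (k := k) (n := n) (m := m) (modGammaPiece (k := k) (n := n) (m := m) G)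
      (modGammaPiece (k := k) (n := n) (m := m) H) := by
  obtain ⟨φ, hφ⟩ := h
  have hmem : ∀ x, x ∈ gammaB (k := k) (n := n) (m := m) M ↔
      φ x ∈ gammaB (k := k) (n := n) (m := m) N := fun x => by
    simp only [mem_gammaB, ← map_smul, LinearEquiv.map_eq_zero_iff]
  have hmap : (gammaB (k := k) (n := n) (m := m) M).map (φ : M →ₗ[Cox k n m] N) =
      gammaB (k := k) (n := n) (m := m) N := by
    ext y
    constructor
    · rintro ⟨x, hx, rfl⟩
      exact (hmem x).1 hx
    · intro hy
      exact ⟨φ.symm y, (hmem _).2 (by rwa [φ.apply_symm_apply]), φ.apply_symm_apply y⟩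
  let Φ := Submodule.Quotient.equiv _ _ φ hmap
  refine ⟨Φ, fun e x => ⟨?_, ?_⟩⟩
  · rintro ⟨y, hy, rfl⟩
    exact ⟨φ y, (hφ e y).1 hy, rfl⟩
  · rintro ⟨y, hy, hyx⟩
    refine ⟨φ.symm y, (hφ e _).2 (by rwa [φ.apply_symm_apply]), Φ.injective ?_⟩
    rw [← hyx]
    change Submodule.mkQ _ (φ (φ.symm y)) = _
    rw [φ.apply_symm_apply]
    rfl

theorem mk_mem_gammaB {J : Ideal (Cox k n m)} {f : Cox k n m} :
    Ideal.Quotient.mk J f ∈ gammaB (k := k) (n := n) (m := m) (Cox k n m ⧸ J) ↔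
      ∃ t : ℕ, ∀ b ∈ irrelevant k n m ^ t, b * f ∈ J := by
  refine exists_congr fun t => forall₂_congr fun b _ => ?_
  rw [← Ideal.Quotient.eq_zero_iff_mem]
  rfl

/-- Both double quotients are quotients of S, graded by the images of S_e. Their kernels, the
B-saturations of J and I, coincide because B^t I ⊆ J ⊆ I. -/
theorem gradedIso_modGamma_quot {J I : Ideal (Cox k n m)} (hJI : J ≤ I) {t : ℕ}
    (ht : ∀ b ∈ irrelevant k n m ^ t, ∀ f ∈ I, b * f ∈ J) :
    GradedIso (k := k) (n := n) (m := m)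
      (modGammaPiece (k := k) (n := n) (m := m) (quotPiece J))
      (modGammaPiece (k := k) (n := n) (m := m) (quotPiece I)) := by
  let θ : ∀ K : Ideal (Cox k n m), Cox k n m →ₗ[Cox k n m]
      ((Cox k n m ⧸ K) ⧸ gammaB (k := k) (n := n) (m := m) (Cox k n m ⧸ K)) :=
    fun K => (Submodule.mkQ _).comp (Submodule.mkQ K)
  have hsurj : ∀ K, Function.Surjective (θ K) := fun K =>
    (Submodule.mkQ_surjective _).comp (Submodule.mkQ_surjective K)
  have hker : ∀ K f, f ∈ LinearMap.ker (θ K) ↔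
      ∃ t : ℕ, ∀ b ∈ irrelevant k n m ^ t, b * f ∈ K := fun K f => by
    rw [← mk_mem_gammaB, LinearMap.mem_ker]
    exact Submodule.Quotient.mk_eq_zero _
  have hpiece : ∀ K e x, x ∈ modGammaPiece (k := k) (n := n) (m := m) (quotPiece K) e ↔
      ∃ f ∈ piece k n m e, θ K f = x := fun K e x => by
    constructor
    · rintro ⟨_, ⟨f, hf, rfl⟩, rfl⟩
      exact ⟨f, hf, rfl⟩
    · rintro ⟨f, hf, rfl⟩
      exact ⟨_, ⟨f, hf, rfl⟩, rfl⟩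
  have hk : LinearMap.ker (θ J) = LinearMap.ker (θ I) := by
    ext f
    rw [hker, hker]
    constructor
    · rintro ⟨s, hs⟩
      exact ⟨s, fun b hb => hJI (hs b hb)⟩
    · rintro ⟨s, hs⟩
      refine ⟨t + s, fun b hb => ?_⟩
      rw [pow_add] at hb
      refine Submodule.mul_induction_on hb (fun b hb c hc => ?_) fun b c hb hc => ?_
      · rw [mul_assoc]
        exact ht b hb _ (hs c hc)
      · rw [add_mul]
        exact add_mem hb hc
  let Φ := ((θ J).quotKerEquivOfSurjective (hsurj J)).symm.trans
    ((Submodule.quotEquivOfEq _ _ hk).trans ((θ I).quotKerEquivOfSurjective (hsurj I)))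
  have hΦ : ∀ f, Φ (θ J f) = θ I f := fun f => by
    have : ((θ J).quotKerEquivOfSurjective (hsurj J)).symm (θ J f) = Submodule.mkQ _ f := by
      rw [LinearEquiv.symm_apply_eq]
      rfl
    simp only [Φ, LinearEquiv.trans_apply, this]
    rfl
  refine ⟨Φ, fun e x => ?_⟩
  rw [hpiece, hpiece]
  refine exists_congr fun f => and_congr_right fun _ => ?_
  rw [← hΦ, Φ.injective.eq_iff]

end GradedIso

/-! ### Length bounds for resolutions of S/J. -/

section Resolutions

variable {F : FreeComplex k n m}

namespace FreeComplex

theorem d_d (i : ℕ) (v : F.Mod (i + 1 + 1)) : F.d i (F.d (i + 1) v) = 0 := by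
  simp only [d, Matrix.mulVecLin_apply, Matrix.mulVec_mulVec, F.mat_mul_mat, Matrix.zero_mulVec]

theorem IsResolution.exactMod {M : Type*} [AddCommGroup M] [Module (Cox k n m) M]
    {G : ℤ × ℤ → AddSubgroup M} (hF : F.IsResolution G) (i : ℕ) : ExactMod F.d ⊥ i := by
  intro v hv
  have h := hF.1 (i + 1) i.succ_pos
  rw [Submodule.Quotient.subsingleton_iff, Submodule.submoduleOf, Submodule.comap_subtype_eq_top]
    at h
  have hv' : v ∈ F.cycles (i + 1) := by
    change F.d i v = 0
    exact funext fun a => hv a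
  obtain ⟨w, hw⟩ := h hv'
  exact ⟨w, fun a => by simp [hw]⟩

theorem IsResolution.exists_augmentation {M : Type*} [AddCommGroup M] [Module (Cox k n m) M]
    {G : ℤ × ℤ → AddSubgroup M} (hF : F.IsResolution G) :
    ∃ ψ : (Fin (F.rank 0) → Cox k n m) →ₗ[Cox k n m] M, Function.Surjective ψ ∧
      ∀ v, ψ v = 0 ↔ ∃ w, v = F.d 0 w := by
  obtain ⟨Φ, -⟩ := hF.2
  let ι : F.Mod 0 →ₗ[Cox k n m] F.cycles 0 :=
    LinearMap.codRestrict (F.cycles 0) LinearMap.id fun _ => Submodule.mem_top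
  refine ⟨Φ.toLinearMap ∘ₗ Submodule.mkQ _ ∘ₗ ι, ?_, fun v => ?_⟩
  · refine Φ.surjective.comp ((Submodule.mkQ_surjective _).comp fun v => ⟨v.1, rfl⟩)
  · change Φ (Submodule.mkQ _ (ι v)) = 0 ↔ _
    rw [LinearEquiv.map_eq_zero_iff, Submodule.mkQ_apply, Submodule.Quotient.mk_eq_zero]
    change (∃ w, F.d 0 w = v) ↔ _
    exact exists_congr fun w => eq_comm

theorem IsMinimal.d_apply_mem (hF : F.IsMinimal) (i : ℕ) (v : F.Mod (i + 1)) (a) :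
    F.d i v a ∈ varIdeal k n m := by
  rw [FreeComplex.d, Matrix.mulVecLin_apply, Matrix.mulVec, dotProduct]
  exact Ideal.sum_mem _ fun b _ => Ideal.mul_mem_right (v b) _ (hF i a b)

end FreeComplex

theorem varIdeal_ne_top : varIdeal k n m ≠ ⊤ := by
  rw [Ne, Ideal.eq_top_iff_one, mem_varIdeal_iff]
  simp

/-- Such an automorphism preserves constant terms, so it maps the ideal of the variables onto
itself. -/
theorem span_image_X_eq_varIdeal (φ : Cox k n m ≃ₐ[k] Cox k n m)
    (hφ : ∀ s, φ (X s) ∈ varIdeal k n m) :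
    Ideal.span ((fun s => φ (X s)) '' Set.univ) = varIdeal k n m := by
  have hcoeff : ∀ f, constantCoeff (φ f) = constantCoeff f := fun f => by
    induction f using MvPolynomial.induction_on with
    | C c => rw [← algebraMap_eq, φ.commutes]
    | add p q hp hq => simp [hp, hq]
    | mul_X p s hp =>
      have := mem_varIdeal_iff.1 (hφ s)
      rw [map_mul, map_mul, map_mul, constantCoeff_X, constantCoeff_eq, this,
        mul_zero, mul_zero]
  have h1 : Ideal.span ((fun s => φ (X s)) '' Set.univ) = (varIdeal k n m).map φ := by
    rw [varIdeal, Ideal.map_span, Set.image_univ, ← Set.range_comp]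
    rfl
  rw [h1]
  ext f
  rw [Ideal.mem_map_of_equiv]
  constructor
  · rintro ⟨g, hg, rfl⟩
    rw [mem_varIdeal_iff, ← constantCoeff_eq] at hg ⊢
    rw [hcoeff, hg]
  · intro hf
    refine ⟨φ.symm f, ?_, φ.apply_symm_apply f⟩
    rw [mem_varIdeal_iff, ← constantCoeff_eq] at hf ⊢
    rw [← hcoeff, φ.apply_symm_apply, hf]

/-- A minimal resolution of `S ⧸ J` has length at most `n + m` if `S ⧸ J` has a regular sequence of
length two that extends to a coordinate system. -/
theorem FreeComplex.rank_eq_zero_of_regular {J : Ideal (Cox k n m)}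
    (hF : F.IsMinimalResolution (quotPiece J)) (φ : Cox k n m ≃ₐ[k] Cox k n m)
    (hφ : ∀ s, φ (X s) ∈ varIdeal k n m) {s₀ s₁ : Fin (n + 1) ⊕ Fin (m + 1)}
    {e : Fin (n + m) → Fin (n + 1) ⊕ Fin (m + 1)} (he : Function.Injective e)
    (hrange : Set.range e = {s | s ≠ s₁ ∧ s ≠ s₀}) (hs : s₁ ≠ s₀)
    (h0 : ∀ f, φ (X s₀) * f ∈ J → f ∈ J)
    (h1 : ∀ f, φ (X s₁) * f ∈ J ⊔ Ideal.span {φ (X s₀)} → f ∈ J ⊔ Ideal.span {φ (X s₀)})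
    {i : ℕ} (hi : n + m < i) : F.rank i = 0 := by
  have hne : ∀ j, e j ≠ s₁ ∧ e j ≠ s₀ := fun j =>
    hrange.subset (Set.mem_range_self j)
  let e' : Fin (n + m + 1 + 1) → Fin (n + 1) ⊕ Fin (m + 1) := Fin.cons s₀ (Fin.cons s₁ e)
  have he' : Function.Injective e' := by
    rw [Fin.cons_injective_iff, Fin.cons_injective_iff, Fin.range_cons]
    refine ⟨?_, fun ⟨j, hj⟩ => (hne j).1 hj, he⟩
    rintro (h | ⟨j, hj⟩)
    · exact hs h.symm
    · exact (hne j).2 hj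
  have hsurj : Set.range e' = Set.univ := by
    rw [Fin.range_cons, Fin.range_cons, hrange]
    ext s
    simp only [Set.mem_insert_iff, Set.mem_ofPred_eq, Set.mem_univ, iff_true]
    tauto
  obtain ⟨I, z, hI0, hI, hz, hze, hIN⟩ := exists_regular_seq φ he'
  rw [hsurj, span_image_X_eq_varIdeal φ hφ] at hIN
  have hz0 : z 0 = φ (X s₀) := hze 0
  have hz1 : z 1 = φ (X s₁) := hze 1
  obtain ⟨ψ, hψ, hker⟩ := hF.1.exists_augmentation
  have hI1 : I 1 = Ideal.span {φ (X s₀)} := by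
    rw [hI 0 (by omega), hI0, hz0, bot_sup_eq]
  have hE0 : ∀ i, ExactMod F.d (I 0) i := by
    rw [hI0]
    exact hF.1.exactMod
  -- At index 0 there is no lower place to use; regularity on S/J takes over. Thus the first two
  -- elements cost no homological degree.
  have hE1 : ∀ i, ExactMod F.d (I 1) i
    | 0 => by
      rw [hI 0 (by omega)]
      refine (hE0 0).sup_span (exists_sub_mem_of_smul_sub_mem hψ hker fun f => ?_)
      rw [hI0, hz0, sup_bot_eq]
      exact h0 f
    | i + 1 => by
      rw [hI 0 (by omega)]
      exact ExactMod.succ F.d_d (hz 0 (by omega)) (hE0 i) (hE0 (i + 1))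
  have hE2 : ∀ i, ExactMod F.d (I 2) i
    | 0 => by
      rw [hI 1 (by omega)]
      refine (hE1 0).sup_span (exists_sub_mem_of_smul_sub_mem hψ hker fun f => ?_)
      rw [hI1, hz1]
      exact h1 f
    | i + 1 => by
      rw [hI 1 (by omega)]
      exact ExactMod.succ F.d_d (hz 1 (by omega)) (hE1 i) (hE1 (i + 1))
  obtain ⟨l, rfl⟩ : ∃ l, i = n + m + l + 1 := ⟨i - (n + m + 1), by omega⟩
  -- The other n + m coordinates cost one degree each, and together all of them generate ⟨x, y⟩.
  have hE := ExactMod.of_seq F.d_d hI hz hE2 (n + m) (by omega) l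
  rw [show 2 + (n + m) = n + m + 1 + 1 by omega, hIN] at hE
  exact hE.rank_eq_zero varIdeal_ne_top (hF.2.d_apply_mem _) (hF.2.d_apply_mem _)

/-- A resolution of `S ⧸ J` has length at least `n + m` if some nonzero element of `S ⧸ J` is killed
by `n + m` elements of a coordinate system. -/
theorem FreeComplex.rank_ne_zero_of_socle {J : Ideal (Cox k n m)}
    (hF : F.IsResolution (quotPiece J)) (φ : Cox k n m ≃ₐ[k] Cox k n m) {N : ℕ}
    {e : Fin N → Fin (n + 1) ⊕ Fin (m + 1)} (he : Function.Injective e) {f : Cox k n m}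
    (hf : f ∉ J) (hφf : ∀ j, φ (X (e j)) * f ∈ J) : F.rank N ≠ 0 := by
  obtain ⟨I, z, hI0, hI, hz, hze, -⟩ := exists_regular_seq φ he
  obtain ⟨ψ, hψ, hker⟩ := hF.exists_augmentation
  obtain ⟨s, hs⟩ := hψ (Ideal.Quotient.mk J f)
  refine rank_ne_zero_of_regular_seq F.d_d hI0 hI hz hF.exactMod (s := s) (fun w hw => ?_)
    fun j hj => ?_
  · rw [(hker s).2 ⟨w, hw⟩, eq_comm, Ideal.Quotient.eq_zero_iff_mem] at hs
    exact hf hs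
  · refine (hker _).1 ?_
    rw [map_smul, hs, hze ⟨j, hj⟩]
    exact Ideal.Quotient.eq_zero_iff_mem.2 (hφf ⟨j, hj⟩)

end Resolutions

theorem exists_remaining_variables (i₀ : Fin (n + 1)) (j₀ : Fin (m + 1)) :
    ∃ e : Fin (n + m) → Fin (n + 1) ⊕ Fin (m + 1), Function.Injective e ∧
      Set.range e = {s | s ≠ Sum.inl i₀ ∧ s ≠ Sum.inr j₀} := by
  refine ⟨Sum.map i₀.succAbove j₀.succAbove ∘ finSumFinEquiv.symm,
    (Sum.map_injective.2 ⟨Fin.succAbove_right_injective, Fin.succAbove_right_injective⟩).comp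
      finSumFinEquiv.symm.injective, ?_⟩
  rw [finSumFinEquiv.symm.surjective.range_comp]
  ext (i | j)
  · simp [Fin.exists_succAbove_eq_iff]
  · simp [Fin.exists_succAbove_eq_iff]

/-! ### The two bounds for the ideal of a finite set of points. -/

section PointIdeals

variable {X : Set (Points k n m)} {t : ℕ}

/-- The constant term is the component of degree (0, 0), which vanishes at a point of the cone. -/
theorem coneIdeal_le_varIdeal [Infinite k] (hX : X.Nonempty) : coneIdeal X ≤ varIdeal k n m := by
  classical
  intro f hf
  by_contra h
  have hf0 := bihomComponent_mem (fun _ => xComponent_mem_coneIdeal)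
    (fun _ => yComponent_mem_coneIdeal) hf 0
  have hcoeff : coeff 0 (weightedHomogeneousComponent (bideg n m) 0 f) = coeff 0 f := by
    rw [coeff_weightedHomogeneousComponent, if_pos (map_zero _)]
  have hC := IsBihom.eq_C (f := weightedHomogeneousComponent (bideg n m) 0 f)
    (weightedHomogeneousComponent_isWeightedHomogeneous _ _)
    (by rwa [mem_varIdeal_iff, hcoeff, ← mem_varIdeal_iff])
  obtain ⟨p, hp⟩ := hX
  have := mem_coneIdeal.1 hf0 (p.1.rep, p.2.rep) ⟨p.1.rep_nonzero, p.2.rep_nonzero, by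
    rwa [Projectivization.mk_rep, Projectivization.mk_rep]⟩
  rw [hC, eval_C, hcoeff] at this
  exact h (mem_varIdeal_iff.2 this)

/-- A coordinate system that contains `∑ cⱼ yⱼ` and `∑ bᵢ xᵢ + y_{j₁}`. -/
theorem exists_coordinates {b : Fin (n + 1) → k} {c : Fin (m + 1) → k} {i₀ : Fin (n + 1)}
    {j₀ j₁ : Fin (m + 1)} (hb : b i₀ ≠ 0) (hc : c j₀ ≠ 0) (hj : j₁ ≠ j₀) :
    ∃ φ : Cox k n m ≃ₐ[k] Cox k n m,
      φ (MvPolynomial.X (Sum.inr j₀)) = yForm n m c ∧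
      φ (MvPolynomial.X (Sum.inl i₀)) = xForm n m b + MvPolynomial.X (Sum.inr j₁) ∧
      ∀ s, s ≠ Sum.inl i₀ → s ≠ Sum.inr j₀ → φ (MvPolynomial.X s) = MvPolynomial.X s := by
  classical
  let β : Fin (n + 1) ⊕ Fin (m + 1) → k :=
    Sum.elim (fun i => if i = i₀ then b i₀ else 1) fun j => if j = j₀ then c j₀ else 1
  let L : Fin (n + 1) ⊕ Fin (m + 1) → Cox k n m :=
    Sum.elim
      (fun i => if i = i₀ then
        ∑ i ∈ Finset.univ.erase i₀, C (b i) * MvPolynomial.X (Sum.inl i) + MvPolynomial.X (Sum.inr j₁) else 0)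
      fun j => if j = j₀ then ∑ j ∈ Finset.univ.erase j₀, C (c j) * MvPolynomial.X (Sum.inr j) else 0
  have hmem : ∀ s, s ≠ Sum.inl i₀ → s ≠ Sum.inr j₀ →
      (MvPolynomial.X s : Cox k n m) ∈ Algebra.adjoin k (MvPolynomial.X '' {t | β t = 1 ∧ L t = 0}) := by
    rintro (i | j) h1 h2
    · exact Algebra.subset_adjoin ⟨_, by simp [β, L, show i ≠ i₀ from fun h => h1 (h ▸ rfl)], rfl⟩
    · exact Algebra.subset_adjoin ⟨_, by simp [β, L, show j ≠ j₀ from fun h => h2 (h ▸ rfl)], rfl⟩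
  have hCX : ∀ (a : k) s, s ≠ Sum.inl i₀ → s ≠ Sum.inr j₀ →
      (C a * MvPolynomial.X s : Cox k n m) ∈ Algebra.adjoin k (MvPolynomial.X '' {t | β t = 1 ∧ L t = 0}) :=
    fun a s h1 h2 => mul_mem (Subalgebra.algebraMap_mem _ a) (hmem s h1 h2)
  have hβ : ∀ s, β s ≠ 0 := by
    rintro (i | j)
    · by_cases h : i = i₀ <;> simp [β, h, hb]
    · by_cases h : j = j₀ <;> simp [β, h, hc]
  have hL : ∀ s, L s ∈ Algebra.adjoin k (MvPolynomial.X '' {t | β t = 1 ∧ L t = 0}) := by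
    rintro (i | j)
    · by_cases h : i = i₀
      · simp only [L, Sum.elim_inl, if_pos h]
        refine add_mem (sum_mem fun i hi => hCX _ _ ?_ (by simp)) (hmem _ (by simp) (by simpa))
        simpa using hi
      · simp [L, h]
    · by_cases h : j = j₀
      · simp only [L, Sum.elim_inr, if_pos h]
        refine sum_mem fun j hj => hCX _ _ (by simp) ?_
        simpa using hj
      · simp [L, h]
  obtain ⟨φ, hφ⟩ := exists_equiv_X β L hβ hL
  refine ⟨φ, ?_, ?_, ?_⟩
  · rw [hφ, yForm, ← Finset.add_sum_erase _ _ (Finset.mem_univ j₀)]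
    simp [β, L]
  · rw [hφ, xForm, ← Finset.add_sum_erase _ _ (Finset.mem_univ i₀), add_assoc]
    simp only [β, L, Sum.elim_inl, if_pos]
  · rintro (i | j) h1 h2
    · have : i ≠ i₀ := fun h => h1 (h ▸ rfl)
      simp [hφ, β, L, this]
    · have : j ≠ j₀ := fun h => h2 (h ▸ rfl)
      simp [hφ, β, L, this]

/-- A coordinate system, all but two elements of which vanish at a given point. -/
theorem exists_coordinates_vanishing {u : Fin (n + 1) → k} {v : Fin (m + 1) → k}
    {i₀ : Fin (n + 1)} {j₀ : Fin (m + 1)} (hu : u i₀ ≠ 0) (hv : v j₀ ≠ 0) :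
    ∃ φ : Cox k n m ≃ₐ[k] Cox k n m, ∀ s, s ≠ Sum.inl i₀ → s ≠ Sum.inr j₀ →
      ∀ a a' : k, eval (Sum.elim (a • u) (a' • v)) (φ (MvPolynomial.X s)) = 0 := by
  classical
  let L : Fin (n + 1) ⊕ Fin (m + 1) → Cox k n m :=
    Sum.elim (fun i => if i = i₀ then 0 else C (-(u i / u i₀)) * MvPolynomial.X (Sum.inl i₀))
      fun j => if j = j₀ then 0 else C (-(v j / v j₀)) * MvPolynomial.X (Sum.inr j₀)
  have hL : ∀ s, L s ∈ Algebra.adjoin k (MvPolynomial.X '' {t | (1 : k) = 1 ∧ L t = 0}) := by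
    rintro (i | j)
    · by_cases h : i = i₀
      · simp [L, h]
      · simp only [L, Sum.elim_inl, if_neg h]
        exact mul_mem (Subalgebra.algebraMap_mem _ _)
          (Algebra.subset_adjoin ⟨Sum.inl i₀, by simp, rfl⟩)
    · by_cases h : j = j₀
      · simp [L, h]
      · simp only [L, Sum.elim_inr, if_neg h]
        exact mul_mem (Subalgebra.algebraMap_mem _ _)
          (Algebra.subset_adjoin ⟨Sum.inr j₀, by simp, rfl⟩)
  obtain ⟨φ, hφ⟩ := exists_equiv_X (fun _ => 1) L (fun _ => one_ne_zero) hL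
  refine ⟨φ, ?_⟩
  rintro (i | j) h1 h2 a a'
  · have : i ≠ i₀ := fun h => h1 (h ▸ rfl)
    simp [hφ, L, this]
    field_simp
    ring
  · have : j ≠ j₀ := fun h => h2 (h ▸ rfl)
    simp [hφ, L, this]
    field_simp
    ring

/-- A form that vanishes at a point `q` and not at a different point `p`. -/
theorem exists_separating {p q : Points k n m} (hpq : q ≠ p) :
    ∃ f : Cox k n m, eval (Sum.elim p.1.rep p.2.rep) f ≠ 0 ∧ f ∈ coneIdeal {q} := by
  by_cases h : p.1 = q.1
  · have h2 : p.2 ≠ q.2 := fun h2 => hpq (Prod.ext h.symm h2.symm)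
    obtain ⟨c, hc1, hc2⟩ := exists_dotProduct_eq_zero_ne_zero p.2.rep_nonzero q.2.rep_nonzero
      (by rwa [Projectivization.mk_rep, Projectivization.mk_rep])
    refine ⟨yForm n m c, by rwa [eval_yForm], mem_coneIdeal.2 ?_⟩
    rintro ⟨u, v⟩ ⟨hu, hv, rfl⟩
    obtain ⟨a, ha⟩ := Projectivization.exists_smul_eq_mk_rep k v hv
    rw [eval_yForm]
    rw [← ha, Units.smul_def, dotProduct_smul, smul_eq_mul] at hc2
    exact (mul_eq_zero.1 hc2).resolve_left a.ne_zero
  · obtain ⟨c, hc1, hc2⟩ := exists_dotProduct_eq_zero_ne_zero p.1.rep_nonzero q.1.rep_nonzero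
      (by rwa [Projectivization.mk_rep, Projectivization.mk_rep])
    refine ⟨xForm n m c, by rwa [eval_xForm], mem_coneIdeal.2 ?_⟩
    rintro ⟨u, v⟩ ⟨hu, hv, rfl⟩
    obtain ⟨a, ha⟩ := Projectivization.exists_smul_eq_mk_rep k u hu
    rw [eval_xForm]
    rw [← ha, Units.smul_def, dotProduct_smul, smul_eq_mul] at hc2
    exact (mul_eq_zero.1 hc2).resolve_left a.ne_zero

/-- A polynomial in `⟨x⟩ ^ t` that vanishes at all points of `X` but one. -/
theorem exists_separating_mem_xIdeal_pow (hX : X.Finite) (p : Points k n m) (t : ℕ) :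
    ∃ f ∈ xIdeal k n m ^ t, eval (Sum.elim p.1.rep p.2.rep) f ≠ 0 ∧
      ∀ q ∈ X, q ≠ p → f ∈ coneIdeal {q} := by
  classical
  obtain ⟨i₀, hi₀⟩ := Function.ne_iff.1 p.1.rep_nonzero
  have hsep : ∀ q : Points k n m, ∃ f : Cox k n m,
      q ≠ p → eval (Sum.elim p.1.rep p.2.rep) f ≠ 0 ∧ f ∈ coneIdeal {q} := fun q => by
    by_cases h : q = p
    · exact ⟨0, fun h' => absurd h h'⟩
    · obtain ⟨f, hf⟩ := exists_separating h
      exact ⟨f, fun _ => hf⟩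
  choose G hG using hsep
  refine ⟨MvPolynomial.X (Sum.inl i₀) ^ t * ∏ q ∈ hX.toFinset.erase p, G q,
    Ideal.mul_mem_right _ _ (Ideal.pow_mem_pow (Ideal.subset_span (Set.mem_range_self i₀)) t),
    ?_, fun q hq hqp => ?_⟩
  · rw [map_mul, map_pow, map_prod, eval_X]
    exact mul_ne_zero (pow_ne_zero _ hi₀)
      (Finset.prod_ne_zero_iff.2 fun q hq => (hG q (Finset.ne_of_mem_erase hq)).1)
  · exact Ideal.mul_mem_left _ _ (Ideal.prod_mem _
      (Finset.mem_erase.2 ⟨hqp, hX.mem_toFinset.2 hq⟩) (hG q hqp).2)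

theorem rank_ne_zero_of_points {F : FreeComplex k n m} (hX : X.Finite) (hne : X.Nonempty)
    (hF : F.IsResolution (quotPiece (coneIdeal X ⊓ xIdeal k n m ^ t))) :
    F.rank (n + m) ≠ 0 := by
  obtain ⟨p, hp⟩ := hne
  obtain ⟨i₀, hi₀⟩ := Function.ne_iff.1 p.1.rep_nonzero
  obtain ⟨j₀, hj₀⟩ := Function.ne_iff.1 p.2.rep_nonzero
  obtain ⟨φ, hφ⟩ := exists_coordinates_vanishing hi₀ hj₀
  obtain ⟨e, he, hrange⟩ := exists_remaining_variables i₀ j₀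
  obtain ⟨s, hst, hs0, hs⟩ := exists_separating_mem_xIdeal_pow hX p t
  have hpc : (p.1.rep, p.2.rep) ∈ cone X := ⟨p.1.rep_nonzero, p.2.rep_nonzero, by
    rwa [Projectivization.mk_rep, Projectivization.mk_rep]⟩
  have hsJ : s ∉ coneIdeal X ⊓ xIdeal k n m ^ t := by
    intro h
    have h0 := mem_coneIdeal.1 (Submodule.mem_inf.1 h).1 _ hpc
    exact hs0 h0
  refine FreeComplex.rank_ne_zero_of_socle hF φ he hsJ fun j =>
    Submodule.mem_inf.2 ⟨mem_coneIdeal.2 ?_, Ideal.mul_mem_left _ _ hst⟩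
  rintro ⟨u, v⟩ ⟨hu, hv, hq⟩
  rw [map_mul]
  by_cases h : (Projectivization.mk k u hu, Projectivization.mk k v hv) = p
  · have h1 : Projectivization.mk k u hu = p.1 := congrArg Prod.fst h
    have h2 : Projectivization.mk k v hv = p.2 := congrArg Prod.snd h
    obtain ⟨a, ha⟩ := Projectivization.exists_smul_eq_mk_rep k u hu
    obtain ⟨a', ha'⟩ := Projectivization.exists_smul_eq_mk_rep k v hv
    rw [h1] at ha
    rw [h2] at ha'
    have hej : e j ≠ Sum.inl i₀ ∧ e j ≠ Sum.inr j₀ := hrange.subset (Set.mem_range_self j)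
    -- The coordinates u, v are the chosen representatives of p rescaled by a⁻¹ and a'⁻¹.
    have := hφ (e j) hej.1 hej.2 (a⁻¹ : kˣ) (a'⁻¹ : kˣ)
    rw [← Units.smul_def, ← Units.smul_def, ← ha, ← ha', inv_smul_smul, inv_smul_smul] at this
    rw [this, zero_mul]
  · rw [mem_coneIdeal.1 (hs _ hq h) (u, v) ⟨hu, hv, rfl⟩, mul_zero]

theorem rank_eq_zero_of_points [Infinite k] {F : FreeComplex k n m} (hm : 1 ≤ m) (hX : X.Finite)
    (hne : X.Nonempty) (ht : (Prod.fst '' X).ncard ≤ t + 1)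
    (hF : F.IsMinimalResolution (quotPiece (coneIdeal X ⊓ xIdeal k n m ^ t))) {i : ℕ}
    (hi : n + m < i) : F.rank i = 0 := by
  obtain ⟨b, hb⟩ := exists_forall_dotProduct_ne_zero (hX.image Prod.fst)
  obtain ⟨c, hc⟩ := exists_forall_dotProduct_ne_zero (hX.image Prod.snd)
  replace hb : ∀ q ∈ cone X, b ⬝ᵥ q.1 ≠ 0 := fun q ⟨hu, hv, h⟩ => hb _ hu ⟨_, h, rfl⟩
  replace hc : ∀ q ∈ cone X, c ⬝ᵥ q.2 ≠ 0 := fun q ⟨hu, hv, h⟩ => hc _ hv ⟨_, h, rfl⟩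
  obtain ⟨p, hp⟩ := hne
  have hpc : (p.1.rep, p.2.rep) ∈ cone X := ⟨p.1.rep_nonzero, p.2.rep_nonzero, by
    rwa [Projectivization.mk_rep, Projectivization.mk_rep]⟩
  obtain ⟨i₀, hi₀⟩ : ∃ i, b i ≠ 0 := Function.ne_iff.1 fun h => hb _ hpc (by simp [h])
  obtain ⟨j₀, hj₀⟩ : ∃ j, c j ≠ 0 := Function.ne_iff.1 fun h => hc _ hpc (by simp [h])
  -- Here m ≥ 1 provides a second y-variable, which is regular modulo ∑ cⱼ yⱼ.
  have : Nontrivial (Fin (m + 1)) := Fin.nontrivial_iff_two_le.2 (by omega)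
  obtain ⟨j₁, hj₁⟩ := exists_ne j₀
  obtain ⟨φ, hφ0, hφ1, hφ⟩ := exists_coordinates hi₀ hj₀ hj₁
  obtain ⟨e, he, hrange⟩ := exists_remaining_variables i₀ j₀
  have hX' : ∀ s, (MvPolynomial.X s : Cox k n m) ∈ varIdeal k n m := fun s => Ideal.subset_span ⟨s, rfl⟩
  have hφX : ∀ s, φ (MvPolynomial.X s) ∈ varIdeal k n m := fun s => by
    by_cases h1 : s = Sum.inl i₀
    · rw [h1, hφ1]
      exact Ideal.add_mem _ (Ideal.sum_mem _ fun _ _ => Ideal.mul_mem_left _ _ (hX' _)) (hX' _)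
    · by_cases h2 : s = Sum.inr j₀
      · rw [h2, hφ0]
        exact Ideal.sum_mem _ fun _ _ => Ideal.mul_mem_left _ _ (hX' _)
      · rw [hφ s h1 h2]
        exact hX' s
  have hc0 : yForm n m c ≠ 0 := by
    rw [← hφ0, Ne, map_eq_zero_iff _ φ.injective]
    exact X_ne_zero _
  refine FreeComplex.rank_eq_zero_of_regular hF φ hφX he hrange (by simp)
    (fun f hf => ?_) (fun f hf => ?_) hi
  · rw [hφ0] at hf
    exact mul_yForm_regular hc hc0 hf
  · rw [hφ0, hφ1] at hf
    rw [hφ0]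
    refine xForm_add_regular hX ht hb (isWeightedHomogeneous_yForm c)
      (isWeightedHomogeneous_X k (xWeight n m) (Sum.inr j₁)) (fun u hu => ?_) hf
    have := mem_span_equiv_X_image_of_mul_mem φ (s := {Sum.inr j₀}) (j := Sum.inr j₁) (u := u)
      (by simpa using hj₁)
    rw [Set.image_singleton, hφ0, hφ _ (by simp) (by simpa using hj₁)] at this
    exact this hu

end PointIdeals

end BiProj

/-! ### The main theorem. -/

theorem theorem1p1 {k : Type*} [Field k] [IsAlgClosed k] (n m : ℕ) (hm : 1 ≤ m)
    (X : Set (BiProj.Points k n m)) (hfin : X.Finite) (hne : X.Nonempty)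
    (t : ℕ) (ht : (Prod.fst '' X).ncard ≤ t + 1) :
    (∃ F : BiProj.FreeComplex k n m,
      F.IsMinimalResolution
        (BiProj.quotPiece (BiProj.vanishingIdeal X ⊓ BiProj.xIdeal k n m ^ t))) ∧
    ∀ F : BiProj.FreeComplex k n m,
      F.IsMinimalResolution
        (BiProj.quotPiece (BiProj.vanishingIdeal X ⊓ BiProj.xIdeal k n m ^ t)) →
      F.IsVirtualResolution (BiProj.quotPiece (BiProj.vanishingIdeal X)) ∧
      F.HasLength (n + m) := by
  have : Infinite k := IsAlgClosed.instInfinite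
  rw [BiProj.vanishingIdeal_eq_coneIdeal]
  refine ⟨BiProj.exists_isMinimalResolution (fun f hf e => ?_)
    (inf_le_left.trans (BiProj.coneIdeal_le_varIdeal hne)), fun F hF => ⟨⟨fun i hi => ?_, ?_⟩, ?_, ?_⟩⟩
  · refine BiProj.bihomComponent_mem (J := BiProj.coneIdeal X ⊓ BiProj.xIdeal k n m ^ t)
      (fun f hf a => ?_) (fun f hf b => ?_) hf e
    · exact ⟨BiProj.xComponent_mem_coneIdeal hf.1 a, BiProj.xComponent_mem_xIdeal_pow hf.2 a⟩
    · exact ⟨BiProj.yComponent_mem_coneIdeal hf.1 b, BiProj.yComponent_mem_xIdeal_pow hf.2 b⟩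
  · have := hF.1.1 i hi
    exact ⟨0, fun b _ z => Subsingleton.elim _ _⟩
  · refine hF.1.2.modGamma.trans (BiProj.gradedIso_modGamma_quot inf_le_left (t := t)
      fun b hb f hf => ⟨Ideal.mul_mem_left _ _ hf, Ideal.mul_mem_right _ _ ?_⟩)
    -- B^t ⊆ ⟨x⟩^t, so B^t I_X lies in the intersection.
    exact Ideal.pow_right_mono inf_le_left t hb
  · exact BiProj.rank_ne_zero_of_points hfin hne hF.1
  · exact fun i hi => BiProj.rank_eq_zero_of_points hm hfin hne ht hF hi
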